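/- For a positive integer $\ell$ and an integer $m\ge 0$, let $b_\ell(m)$ denote the number of $\ell$-regular partitions of $m$, that is, of partitions of $m$ none of whose parts is divisible by $\ell$ (so $b_\ell(0)=1$). Then for all integers $n,\beta\ge 0$ and $k\ge 1$, the numbers $$7^{2k+2\beta-1}n+\frac{18\cdot 7^{2k+2\beta-1}-7^{2k-1}+1}{24}\qquad\text{and}\qquad 7^{2k+\beta-1}(n+1)-\frac{7^{2k}-1}{24}$$ are non-negative integers, and $$b_{7^{2k-1}}\left(7^{2k+2\beta-1}n+\frac{18\cdot 7^{2k+2\beta-1}-7^{2k-1}+1}{24}\right)\equiv 0 \pmod{7^{k+\beta}},$$ $$b_{7^{2k}}\left(7^{2k+\beta-1}(n+1)-\frac{7^{2k}-1}{24}\right)\equiv 0\pmod{7^{k+\beta}}.$$ -/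

import Mathlib

/-- The number `b_ℓ(n)` of `ℓ`-regular partitions of `n`, that is, of partitions of `n`
none of whose parts is divisible by `ℓ`. -/
def regularPartitionCount (ℓ n : ℕ) : ℕ :=
  (Nat.Partition.restricted n (fun i => ¬ ℓ ∣ i)).card

open PowerSeries
open scoped PowerSeries.WithPiTopology

/-! Write E(q) = ∏ (1 - q^n); the generating function of b_ℓ is E(q^ℓ)/E(q). Put t = q
E(q^7)^4/E(q)^4 (`hauptmodul`), w = q^2 E(q^49)/E(q) (`eulerQuotient`), and let U (`huffU`) extract
the exponents divisible by 7. Since U(f · g(q^7)) = U(f) g and w^4 = t(q) t(q^7), the action of U on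
the series w^r t^j is governed by the series U(w^i).

The series w is a root of an explicit polynomial of degree 7 over ℤ[t(q^7)] whose roots are the
conjugates w(ζ^k q), ζ a seventh root of unity (`eulerQuotient_pow_seven_and_newton`). Hence 7
U(w^i)(q^7) is a power sum of the roots, and Newton's identities make U(w^i) a polynomial in t with
7-adically small coefficients (`hasHuffBound_huffU_eulerQuotient_pow`). With L = ℤ[7t] the bounds
become U(tL) ⊆ 7tL, U(wL) ⊆ 7tL, U(wtL) ⊆ tL and U(w^3 L) ⊆ tL.

For level 7^(2k), q^N E(q^(49^k))/E(q) with 24N + 1 = 49^k is the product w(q) w(q^49) w(q^(49^2)) ⋯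
of k factors. Applying U to it 2k - 1 times lands in 7^k tL, and every further U gains a factor 7.
For level 7^(2k-1) the same computation applies after exchanging a factor E(q^7) for E(q); that
quotient is carried along while pairs of shifted U's, passing through w^3 L and then wL, gain one
factor 7 each.

The polynomial equation comes from splitting E by exponents modulo 7. Jacobi's formula for E^3
(`jacobiSeries_eq`) yields two relations between the components (`exists_seven_dissection`), which
put them on the Klein quartic; there the equation is a polynomial identity
(`modular_equation_klein`). Its parameter is identified with -t(q^7) through the norm of E. -/

/-! ### Jacobi's identity for the cube of the Euler function -/

/-- Triangular numbers, indexed by all integers. -/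
def triangular (n : ℤ) : ℕ := (n * (n + 1) / 2).toNat

theorem two_mul_triangular (n : ℤ) : 2 * (triangular n : ℤ) = n * (n + 1) := by
  have h0 : 0 ≤ n * (n + 1) := by
    rcases le_or_gt 0 n with h | h
    · positivity
    · nlinarith
  have h1 : Even (n * (n + 1)) := Int.even_mul_succ_self n
  rw [triangular, Int.toNat_of_nonneg (by positivity), Int.two_mul_ediv_two_of_even h1]

theorem finite_triangular_le (d : ℕ) : {n : ℤ | triangular n ≤ d}.Finite := by
  apply (Set.finite_Icc (-(d : ℤ) - 1) d).subset
  intro n hn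
  have h : (triangular n : ℤ) ≤ d := by exact_mod_cast hn
  have h2 := two_mul_triangular n
  constructor
  · by_contra! hc
    nlinarith
  · by_contra! hc
    nlinarith

theorem finite_pentagonal_le (d : ℕ) : {k : ℤ | pentagonal k ≤ d}.Finite :=
  (Set.finite_Iic d).preimage pentagonal_injective.injOn

theorem hasSum_monomial_mk {ι : Type*} (e : ι → ℕ) (c : ι → ℤ) (h : ∀ d, {i | e i = d}.Finite) :
    HasSum (fun i ↦ monomial (e i) (c i)) (∑' i, (monomial (e i) (c i) : ℤ⟦X⟧)) := by
  apply Summable.hasSum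
  rw [WithPiTopology.summable_iff_summable_coeff]
  intro d
  apply summable_of_hasFiniteSupport
  apply (h d).subset
  intro i hi
  by_contra hne
  refine hi ?_
  dsimp only
  rw [coeff_monomial, if_neg (fun h' ↦ hne h'.symm)]

/-- The sum of `(-1)^n (2n+1) q^(n(n+1)/2)` over all integers `n`. -/
noncomputable def jacobiSeries : ℤ⟦X⟧ :=
  ∑' n : ℤ, monomial (triangular n) ((n.negOnePow : ℤ) * (2 * n + 1))

theorem hasSum_jacobiSeries :
    HasSum (fun n : ℤ ↦ monomial (triangular n) ((n.negOnePow : ℤ) * (2 * n + 1)))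
      jacobiSeries :=
  hasSum_monomial_mk _ _ fun d ↦ (finite_triangular_le d).subset fun _ h ↦ le_of_eq h

theorem hasSum_pentagonalSeries_monomial :
    HasSum (fun k : ℤ ↦ monomial (pentagonal k) (k.negOnePow : ℤ)) (pentagonalSeries ℤ) := by
  convert WithPiTopology.hasSum_pentagonalSeries ℤ using 2 with k
  rw [monomial_eq_C_mul_X_pow]
  simp

theorem coeff_X_mul_derivative (f : ℤ⟦X⟧) (n : ℕ) :
    coeff n (X * derivative ℤ f) = n * coeff n f := by
  cases n with
  | zero => simp
  | succ n => rw [coeff_succ_X_mul, coeff_derivative]; push_cast; ring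

theorem HasSum.X_mul_derivative {ι : Type*} {e : ι → ℕ} {c : ι → ℤ} {f : ℤ⟦X⟧}
    (h : HasSum (fun i ↦ monomial (e i) (c i)) f) :
    HasSum (fun i ↦ monomial (e i) (e i * c i)) (X * derivative ℤ f) := by
  rw [WithPiTopology.hasSum_iff_hasSum_coeff] at h ⊢
  intro d
  rw [coeff_X_mul_derivative]
  have heq : (fun i ↦ coeff d (monomial (e i) ((e i : ℤ) * c i))) =
      fun i ↦ (d : ℤ) * coeff d (monomial (e i) (c i)) := by
    ext1 i
    rw [coeff_monomial, coeff_monomial]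
    split_ifs with h
    · rw [h]
    · simp
  rw [heq]
  exact (h d).mul_left (d : ℤ)

theorem HasSum.monomial_mul {ι κ : Type*} {e : ι → ℕ} {c : ι → ℤ} {f : ℤ⟦X⟧}
    {e' : κ → ℕ} {c' : κ → ℤ} {g : ℤ⟦X⟧}
    (hf : HasSum (fun i ↦ monomial (e i) (c i)) f)
    (hg : HasSum (fun i ↦ monomial (e' i) (c' i)) g)
    (he : ∀ d, {i | e i ≤ d}.Finite) (he' : ∀ d, {i | e' i ≤ d}.Finite) :
    HasSum (fun i : ι × κ ↦ monomial (e i.1 + e' i.2) (c i.1 * c' i.2)) (f * g) := by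
  have hfin (d : ℕ) : {i : ι × κ | e i.1 + e' i.2 = d}.Finite := by
    refine ((he d).prod (he' d)).subset fun i hi ↦ ⟨?_, ?_⟩
    · exact le_trans (Nat.le_add_right _ _) (le_of_eq hi)
    · exact le_trans (Nat.le_add_left _ _) (le_of_eq hi)
  have h := (hasSum_monomial_mk (fun i : ι × κ ↦ e i.1 + e' i.2)
    (fun i : ι × κ ↦ c i.1 * c' i.2) hfin).summable
  have heq : (fun i : ι × κ ↦ (monomial (e i.1 + e' i.2) (c i.1 * c' i.2) : ℤ⟦X⟧)) =
      fun i ↦ monomial (e i.1) (c i.1) * monomial (e' i.2) (c' i.2) :=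
    funext fun i ↦ (monomial_mul_monomial _ _ _ _).symm
  rw [heq] at h ⊢
  exact HasSum.mul (f := fun i ↦ monomial (e i) (c i)) (g := fun i ↦ monomial (e' i) (c' i)) hf hg h

/-- An involution of `ℤ²` preserving `(6k-1)² + 3(2n+1)²`. It is induced by multiplication of
`(6k-1) + (2n+1)√-3` by a cube root of unity. -/
def hexagonalInvolution (v : ℤ × ℤ) : ℤ × ℤ :=
  if Even (v.1 + v.2) then (-(v.1 + v.2) / 2, (3 * v.1 - v.2) / 2 - 1)
  else ((v.2 - v.1 + 1) / 2, (-3 * v.1 - v.2 - 1) / 2)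

theorem hexagonalInvolution_even (a b : ℤ) :
    hexagonalInvolution (a, 2 * b - a) = (-b, 2 * a - b - 1) := by
  have h : Even (a + (2 * b - a)) := ⟨b, by ring⟩
  simp only [hexagonalInvolution, if_pos h]
  ext <;> dsimp only <;> omega

theorem hexagonalInvolution_odd (a b : ℤ) :
    hexagonalInvolution (a, 2 * b - a - 1) = (b - a, -a - b) := by
  have h : ¬ Even (a + (2 * b - a - 1)) := by
    rw [Int.not_even_iff_odd]; exact ⟨b - 1, by ring⟩
  simp only [hexagonalInvolution, if_neg h]
  ext <;> dsimp only <;> omega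

theorem exists_parity_form (v : ℤ × ℤ) :
    (∃ a b : ℤ, v = (a, 2 * b - a)) ∨ ∃ a b : ℤ, v = (a, 2 * b - a - 1) := by
  obtain ⟨k, n⟩ := v
  rcases Int.even_or_odd' (k + n) with ⟨b, h | h⟩
  · exact .inl ⟨k, b, by ext <;> dsimp only; omega⟩
  · exact .inr ⟨k, b + 1, by ext <;> dsimp only; omega⟩

theorem hexagonalInvolution_involutive : Function.Involutive hexagonalInvolution := by
  intro v
  rcases exists_parity_form v with ⟨a, b, rfl⟩ | ⟨a, b, rfl⟩
  · rw [hexagonalInvolution_even, show ((-b, 2 * a - b - 1) : ℤ × ℤ) =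
      (-b, 2 * (a - b) - (-b) - 1) by ext <;> dsimp only; ring, hexagonalInvolution_odd]
    ext <;> dsimp only <;> ring
  · rw [hexagonalInvolution_odd, show ((b - a, -a - b) : ℤ × ℤ) =
      (b - a, 2 * (-a) - (b - a)) by ext <;> dsimp only; ring, hexagonalInvolution_even]
    ext <;> dsimp only <;> ring

theorem exponent_hexagonalInvolution (v : ℤ × ℤ) :
    pentagonal (hexagonalInvolution v).1 + triangular (hexagonalInvolution v).2 =
      pentagonal v.1 + triangular v.2 := by
  zify
  apply mul_left_cancel₀ (two_ne_zero' ℤ)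
  rw [mul_add, mul_add, two_mul_natCast_pentagonal, two_mul_natCast_pentagonal,
    two_mul_triangular, two_mul_triangular]
  rcases exists_parity_form v with ⟨a, b, rfl⟩ | ⟨a, b, rfl⟩
  · rw [hexagonalInvolution_even]; dsimp only; ring
  · rw [hexagonalInvolution_odd]; dsimp only; ring

/-- The coefficient attached to `(k, n)` in `E * θJ - 3 * J * θE`. -/
def hexagonalWeight (v : ℤ × ℤ) : ℤ :=
  (v.1.negOnePow : ℤ) * (v.2.negOnePow * (2 * v.2 + 1)) *
    (triangular v.2 - 3 * pentagonal v.1)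

/-- With u = 6k - 1 and v = 2n + 1 the weight is, up to sign and a constant, v(v² - u²), which is
proportional to the √-3-part of (u + v√-3)^3. Multiplication by a cube root of unity fixes this
cube, while the involution changes the parity of k + n and hence the sign. -/
theorem hexagonalWeight_involution (v : ℤ × ℤ) :
    hexagonalWeight (hexagonalInvolution v) = -hexagonalWeight v := by
  apply mul_left_cancel₀ (two_ne_zero' ℤ)
  have key (k n : ℤ) : 2 * hexagonalWeight (k, n) =
      ((k + n).negOnePow : ℤ) * ((2 * n + 1) * (n * (n + 1) - 3 * (k * (3 * k - 1)))) := by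
    rw [← two_mul_triangular, ← two_mul_natCast_pentagonal, hexagonalWeight, Int.negOnePow_add]
    push_cast; ring
  rw [mul_neg]
  rcases exists_parity_form v with ⟨a, b, rfl⟩ | ⟨a, b, rfl⟩
  · rw [hexagonalInvolution_even, key, key,
      Int.negOnePow_odd _ (show Odd (-b + (2 * a - b - 1)) from ⟨a - b - 1, by ring⟩),
      Int.negOnePow_even _ (show Even (a + (2 * b - a)) from ⟨b, by ring⟩)]
    push_cast; ring
  · rw [hexagonalInvolution_odd, key, key,
      Int.negOnePow_even _ (show Even (b - a + (-a - b)) from ⟨-a, by ring⟩),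
      Int.negOnePow_odd _ (show Odd (a + (2 * b - a - 1)) from ⟨b - 1, by ring⟩)]
    push_cast; ring

/-- This is the logarithmic derivative of J = const · E^3 with denominators cleared. The difference
of the two sides is a double sum over ℤ² that the involution sends to its negative. -/
theorem pentagonalSeries_mul_derivative_jacobiSeries :
    pentagonalSeries ℤ * (X * derivative ℤ jacobiSeries) =
      3 * (X * derivative ℤ (pentagonalSeries ℤ) * jacobiSeries) := by
  have h1 := hasSum_pentagonalSeries_monomial.monomial_mul hasSum_jacobiSeries.X_mul_derivative
    finite_pentagonal_le finite_triangular_le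
  have h2 := hasSum_pentagonalSeries_monomial.X_mul_derivative.monomial_mul hasSum_jacobiSeries
    finite_pentagonal_le finite_triangular_le
  have h3 := h1.sub (h2.mul_left 3)
  have h4 : HasSum (fun v : ℤ × ℤ ↦
      (monomial (pentagonal v.1 + triangular v.2) (hexagonalWeight v) : ℤ⟦X⟧))
      (pentagonalSeries ℤ * (X * derivative ℤ jacobiSeries) -
        3 * (X * derivative ℤ (pentagonalSeries ℤ) * jacobiSeries)) := by
    refine (congrArg (HasSum · _) (funext fun v ↦ ?_)).mpr h3
    rw [show (3 : ℤ⟦X⟧) = C 3 by simp, ← smul_eq_C_mul, ← map_smul, ← map_sub]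
    congr 1
    rw [hexagonalWeight, smul_eq_mul]
    ring
  have h5 := (hexagonalInvolution_involutive.toPerm).hasSum_iff.mpr h4
  have h6 : (fun v : ℤ × ℤ ↦
      (monomial (pentagonal v.1 + triangular v.2) (hexagonalWeight v) : ℤ⟦X⟧)) ∘
      hexagonalInvolution_involutive.toPerm = fun v ↦
      -(monomial (pentagonal v.1 + triangular v.2) (hexagonalWeight v) : ℤ⟦X⟧) := by
    ext1 v
    simp only [Function.comp_apply, Function.Involutive.coe_toPerm]
    rw [exponent_hexagonalInvolution, hexagonalWeight_involution, map_neg]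
  rw [h6] at h5
  -- The double sum equals its own negative, so twice it vanishes.
  have h7 := h5.unique h4.neg
  apply mul_left_cancel₀ (show (C (2 : ℤ) : ℤ⟦X⟧) ≠ 0 by
    rw [Ne, map_eq_zero_iff _ C_injective]; norm_num)
  rw [show (C (2 : ℤ) : ℤ⟦X⟧) = 2 by simp]
  linear_combination h7

theorem coeff_jacobiSeries (d : ℕ) :
    HasSum (fun n : ℤ ↦ if d = triangular n then (n.negOnePow : ℤ) * (2 * n + 1) else 0)
      (coeff d jacobiSeries) := by
  have h := (WithPiTopology.hasSum_iff_hasSum_coeff ℤ).mp hasSum_jacobiSeries d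
  simpa only [coeff_monomial] using h

theorem constantCoeff_pentagonalSeries : constantCoeff (pentagonalSeries ℤ) = 1 := by
  rw [← coeff_zero_eq_constantCoeff_apply]
  exact (coeff_pentagonalSeries_pentagonal ℤ 0).trans (by simp)

theorem constantCoeff_jacobiSeries : constantCoeff jacobiSeries = 2 := by
  rw [← coeff_zero_eq_constantCoeff_apply]
  refine (coeff_jacobiSeries 0).unique ?_
  -- The indices n and -1 - n give equal terms, so this series is twice Jacobi's usual one; here n =
  -- 0 and n = -1 contribute 1 each.
  have h : ∀ n : ℤ, n ∉ ({0, -1} : Finset ℤ) →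
      (if 0 = triangular n then (n.negOnePow : ℤ) * (2 * n + 1) else 0) = 0 := by
    intro n hn
    rw [if_neg]
    intro h0
    have := two_mul_triangular n
    rw [← h0] at this
    simp only [Nat.cast_zero, mul_zero, zero_eq_mul] at this
    simp only [Finset.mem_insert, Finset.mem_singleton] at hn
    omega
  have h1 := hasSum_sum_of_ne_finset_zero h (L := .unconditional ℤ)
  simpa [triangular] using h1

/-- The reciprocal of the Euler function, that is, the generating function of partitions. -/
noncomputable def eulerInv : ℤ⟦X⟧ := invOfUnit (pentagonalSeries ℤ) 1

theorem pentagonalSeries_mul_eulerInv : pentagonalSeries ℤ * eulerInv = 1 :=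
  mul_invOfUnit _ _ (by simp [constantCoeff_pentagonalSeries])

theorem constantCoeff_eulerInv : constantCoeff eulerInv = 1 := by
  simpa [constantCoeff_pentagonalSeries] using
    congrArg constantCoeff pentagonalSeries_mul_eulerInv

theorem pentagonalSeries_ne_zero : pentagonalSeries ℤ ≠ 0 := by
  intro h
  simpa [h] using constantCoeff_pentagonalSeries

/-- Jacobi's identity for the cube of the Euler function. -/
theorem jacobiSeries_eq : jacobiSeries = 2 * pentagonalSeries ℤ ^ 3 := by
  have hP := pentagonalSeries_mul_eulerInv
  have hd : pentagonalSeries ℤ * derivative ℤ eulerInv =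
      -(eulerInv * derivative ℤ (pentagonalSeries ℤ)) := by
    have := congrArg (derivative ℤ) hP
    rw [Derivation.leibniz, smul_eq_mul, smul_eq_mul, derivative_one] at this
    linear_combination this
  have hJ : pentagonalSeries ℤ * derivative ℤ jacobiSeries =
      3 * (derivative ℤ (pentagonalSeries ℤ) * jacobiSeries) := by
    apply mul_left_cancel₀ (X_ne_zero (R := ℤ))
    linear_combination pentagonalSeries_mul_derivative_jacobiSeries
  -- J/E^3 has zero derivative, so it equals its constant term 2.
  have h0 : derivative ℤ (jacobiSeries * eulerInv ^ 3) = derivative ℤ (C (2 : ℤ)) := by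
    rw [derivative_C, Derivation.leibniz, Derivation.leibniz_pow]
    simp only [smul_eq_mul, nsmul_eq_mul, Nat.cast_ofNat, Nat.add_one_sub_one]
    apply mul_left_cancel₀ pentagonalSeries_ne_zero
    linear_combination (3 * jacobiSeries * eulerInv ^ 2) * hd + eulerInv ^ 3 * hJ
  have h1 : jacobiSeries * eulerInv ^ 3 = C (2 : ℤ) :=
    derivative.ext h0 (by
      rw [map_mul, map_pow, constantCoeff_jacobiSeries, constantCoeff_eulerInv, constantCoeff_C]
      norm_num)
  have h2 : (C (2 : ℤ) : ℤ⟦X⟧) = 2 := by simp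
  rw [h2] at h1
  calc jacobiSeries = jacobiSeries * (pentagonalSeries ℤ * eulerInv) ^ 3 := by rw [hP]; ring
    _ = _ := by linear_combination pentagonalSeries ℤ ^ 3 * h1

/-! ### Exponents in a fixed residue class modulo 7 -/

section Residue

/-- The exponents of `f` all lie in the residue class `r` modulo `7`. -/
def IsClass (r : ZMod 7) (f : ℤ⟦X⟧) : Prop :=
  ∀ n : ℕ, (n : ZMod 7) ≠ r → coeff n f = 0

/-- The part of `f` whose exponents lie in the residue class `r` modulo `7`. -/
noncomputable def residuePart (r : ZMod 7) : ℤ⟦X⟧ →+ ℤ⟦X⟧ where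
  toFun f := mk fun n ↦ if (n : ZMod 7) = r then coeff n f else 0
  map_add' f g := by
    ext n
    simp only [coeff_mk, map_add]
    split_ifs <;> simp
  map_zero' := by
    ext n
    simp

theorem coeff_residuePart (r : ZMod 7) (f : ℤ⟦X⟧) (n : ℕ) :
    coeff n (residuePart r f) = if (n : ZMod 7) = r then coeff n f else 0 :=
  coeff_mk n fun n : ℕ ↦ if (n : ZMod 7) = r then coeff n f else 0

theorem isClass_residuePart (r : ZMod 7) (f : ℤ⟦X⟧) : IsClass r (residuePart r f) := by
  intro n hn
  rw [coeff_residuePart, if_neg hn]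

theorem IsClass.residuePart_eq {r : ZMod 7} {f : ℤ⟦X⟧} (h : IsClass r f) (s : ZMod 7) :
    residuePart s f = if r = s then f else 0 := by
  ext n
  rw [coeff_residuePart]
  by_cases hn : (n : ZMod 7) = r
  · subst hn
    split_ifs <;> simp
  · have := h n hn
    split_ifs <;> simp [this]

theorem isClass_one : IsClass 0 1 := by
  intro n hn
  rw [coeff_one, if_neg]
  rintro rfl
  simp at hn

theorem IsClass.mul {r s : ZMod 7} {f g : ℤ⟦X⟧} (hf : IsClass r f) (hg : IsClass s g) :
    IsClass (r + s) (f * g) := by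
  intro n hn
  rw [coeff_mul]
  apply Finset.sum_eq_zero
  rintro ⟨i, j⟩ hij
  replace hij := Finset.HasAntidiagonal.mem_antidiagonal.mp hij
  by_cases hi : (i : ZMod 7) = r
  · rw [hg j, mul_zero]
    rintro hj
    apply hn
    rw [← hij, Nat.cast_add, hi, hj]
  · rw [hf i hi, zero_mul]

theorem IsClass.pow {r : ZMod 7} {f : ℤ⟦X⟧} (hf : IsClass r f) (n : ℕ) :
    IsClass (n * r) (f ^ n) := by
  induction n with
  | zero => simpa using isClass_one
  | succ n ih =>
    rw [pow_succ, Nat.cast_succ, add_mul, one_mul]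
    exact ih.mul hf

theorem IsClass.add {r : ZMod 7} {f g : ℤ⟦X⟧} (hf : IsClass r f) (hg : IsClass r g) :
    IsClass r (f + g) := fun n hn ↦ by rw [map_add, hf n hn, hg n hn, add_zero]

theorem IsClass.smul {r : ZMod 7} {f : ℤ⟦X⟧} (hf : IsClass r f) (c : ℤ) :
    IsClass r (c • f) := fun n hn ↦ by rw [map_zsmul, hf n hn, smul_zero]

theorem isClass_X_pow (m : ℕ) : IsClass m (X ^ m) := by
  intro n hn
  rw [coeff_X_pow, if_neg]
  rintro rfl
  exact hn rfl

theorem isClass_expand {m : ℕ} (hm : m ≠ 0) (h7 : 7 ∣ m) (f : ℤ⟦X⟧) :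
    IsClass 0 (expand m hm f) := by
  intro n hn
  apply coeff_expand_of_not_dvd
  intro h
  exact hn ((ZMod.natCast_eq_zero_iff n 7).mpr (h7.trans h))

end Residue

/-! ### The 7-dissections of E and of E^3 -/

theorem pentagonal_seven_mul_sub_one (j : ℤ) :
    pentagonal (7 * j - 1) = 49 * pentagonal j + 2 := by
  zify
  apply mul_left_cancel₀ (two_ne_zero' ℤ)
  rw [mul_add, mul_left_comm, two_mul_natCast_pentagonal, two_mul_natCast_pentagonal]
  ring

theorem triangular_seven_mul_add_three (j : ℤ) :
    triangular (7 * j + 3) = 49 * triangular j + 6 := by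
  zify
  apply mul_left_cancel₀ (two_ne_zero' ℤ)
  rw [mul_add, mul_left_comm, two_mul_triangular, two_mul_triangular]
  ring

theorem pentagonal_zmod (k : ℤ) :
    (pentagonal k : ZMod 7) = 4 * ((k : ZMod 7) * (3 * k - 1)) := by
  have h := congrArg (Int.cast (R := ZMod 7)) (two_mul_natCast_pentagonal k)
  push_cast at h
  rw [← h, ← mul_assoc, show (4 * 2 : ZMod 7) = 1 by decide, one_mul]

theorem triangular_zmod (n : ℤ) :
    (triangular n : ZMod 7) = 4 * ((n : ZMod 7) * (n + 1)) := by
  have h := congrArg (Int.cast (R := ZMod 7)) (two_mul_triangular n)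
  push_cast at h
  rw [← h, ← mul_assoc, show (4 * 2 : ZMod 7) = 1 by decide, one_mul]

theorem exists_of_pentagonal_zmod_eq_two {k : ℤ} (h : (pentagonal k : ZMod 7) = 2) :
    ∃ j, k = 7 * j - 1 := by
  rw [pentagonal_zmod] at h
  have h1 : ∀ x : ZMod 7, 4 * (x * (3 * x - 1)) = 2 → x + 1 = 0 := by decide
  have h2 : ((k + 1 : ℤ) : ZMod 7) = 0 := by push_cast; exact h1 _ h
  obtain ⟨j, hj⟩ := (ZMod.intCast_zmod_eq_zero_iff_dvd _ 7).mp h2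
  exact ⟨j, by push_cast at hj; linarith⟩

theorem exists_of_triangular_zmod_eq_six {n : ℤ} (h : (triangular n : ZMod 7) = 6) :
    ∃ j, n = 7 * j + 3 := by
  rw [triangular_zmod] at h
  have h1 : ∀ x : ZMod 7, 4 * (x * (x + 1)) = 6 → x - 3 = 0 := by decide
  have h2 : ((n - 3 : ℤ) : ZMod 7) = 0 := by push_cast; exact h1 _ h
  obtain ⟨j, hj⟩ := (ZMod.intCast_zmod_eq_zero_iff_dvd _ 7).mp h2
  exact ⟨j, by push_cast at hj; linarith⟩

/-- A pentagonal exponent is 2 modulo 7 only at k = 7j - 1, where it is 49 times the j-th one plus 2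
and the sign is opposite to that of j. -/
theorem residuePart_two_pentagonalSeries :
    residuePart 2 (pentagonalSeries ℤ) = -(X ^ 2 * expand 49 (by norm_num) (pentagonalSeries ℤ)) := by
  ext n
  rw [coeff_residuePart]
  by_cases hn : (n : ZMod 7) = 2
  · rw [if_pos hn, map_neg, coeff_X_pow_mul']
    by_cases hr : n ∈ Set.range pentagonal
    · obtain ⟨k, rfl⟩ := hr
      obtain ⟨j, rfl⟩ := exists_of_pentagonal_zmod_eq_two hn
      have h1 : (7 * j - 1).negOnePow = -j.negOnePow := by
        rw [show 7 * j - 1 = j + (2 * (3 * j - 1) + 1) by ring, Int.negOnePow_add,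
          Int.negOnePow_two_mul_add_one]
        simp
      rw [coeff_pentagonalSeries_pentagonal, pentagonal_seven_mul_sub_one, if_pos (by omega),
        Nat.add_sub_cancel, coeff_expand_mul, coeff_pentagonalSeries_pentagonal, h1]
      simp
    · rw [coeff_pentagonalSeries_eq_zero ℤ hr]
      split_ifs with h2
      · rw [coeff_expand]
        split_ifs with h49
        · obtain ⟨m, hm⟩ := h49
          rw [hm, Nat.mul_div_cancel_left _ (by norm_num), coeff_pentagonalSeries_eq_zero, neg_zero]
          rintro ⟨j, rfl⟩
          exact hr ⟨7 * j - 1, by rw [pentagonal_seven_mul_sub_one]; omega⟩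
        · simp
      · simp
  · rw [if_neg hn, map_neg, (isClass_X_pow 2).mul (isClass_expand _ (by norm_num) _) n (by simpa),
      neg_zero]

theorem coeff_pentagonalSeries_of_zmod {n : ℕ}
    (h : (n : ZMod 7) = 3 ∨ (n : ZMod 7) = 4 ∨ (n : ZMod 7) = 6) :
    coeff n (pentagonalSeries ℤ) = 0 := by
  apply coeff_pentagonalSeries_eq_zero
  rintro ⟨k, rfl⟩
  rw [pentagonal_zmod] at h
  have h1 : ∀ x : ZMod 7, ¬ (4 * (x * (3 * x - 1)) = 3 ∨ 4 * (x * (3 * x - 1)) = 4 ∨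
    4 * (x * (3 * x - 1)) = 6) := by decide
  exact h1 _ h

theorem residuePart_two_jacobiSeries : residuePart 2 jacobiSeries = 0 := by
  ext n
  rw [coeff_residuePart, map_zero]
  split_ifs with hn
  · refine (coeff_jacobiSeries n).unique ?_
    convert hasSum_zero using 2 with k
    rw [if_neg]
    rintro rfl
    rw [triangular_zmod] at hn
    have h1 : ∀ x : ZMod 7, 4 * (x * (x + 1)) ≠ 2 := by decide
    exact h1 _ hn
  · rfl

/-- Only n = 7j + 3 contributes: 2n + 1 = 7(2j + 1) and the parity of n is opposite to that of j,
whence the factor -7. -/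
theorem residuePart_six_jacobiSeries :
    residuePart 6 jacobiSeries = (-7 : ℤ) • (X ^ 6 * expand 49 (by norm_num) jacobiSeries) := by
  ext n
  rw [coeff_residuePart]
  by_cases hn : (n : ZMod 7) = 6
  · rw [if_pos hn, map_zsmul, coeff_X_pow_mul']
    by_cases hm : ∃ m, n = 49 * m + 6
    · obtain ⟨m, rfl⟩ := hm
      rw [if_pos (by omega), Nat.add_sub_cancel, coeff_expand_mul]
      have hinj : Function.Injective fun j : ℤ ↦ 7 * j + 3 := fun a b h ↦ by
        dsimp only at h; omega
      refine (coeff_jacobiSeries (49 * m + 6)).unique ?_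
      rw [← hinj.hasSum_iff]
      · have h1 := (coeff_jacobiSeries m).mul_left (-7)
        refine (congrArg (HasSum · _) (funext fun j ↦ ?_)).mpr h1
        have hs : (7 * j + 3).negOnePow = -j.negOnePow := by
          rw [show 7 * j + 3 = j + (2 * (3 * j + 1) + 1) by ring, Int.negOnePow_add,
            Int.negOnePow_two_mul_add_one]
          simp
        simp only [Function.comp_apply, triangular_seven_mul_add_three, hs]
        by_cases hj : m = triangular j
        · rw [if_pos (by rw [hj]), if_pos hj]; push_cast; ring
        · rw [if_neg (by omega), if_neg hj, mul_zero]
      · intro k hk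
        rw [if_neg]
        intro h
        rw [h] at hn
        obtain ⟨j, rfl⟩ := exists_of_triangular_zmod_eq_six hn
        exact hk ⟨j, rfl⟩
    · have h0 : coeff n jacobiSeries = 0 := by
        refine (coeff_jacobiSeries n).unique ?_
        convert hasSum_zero using 2 with k
        rw [if_neg]
        rintro rfl
        obtain ⟨j, rfl⟩ := exists_of_triangular_zmod_eq_six hn
        exact hm ⟨_, triangular_seven_mul_add_three j⟩
      rw [h0]
      split_ifs with h6
      · rw [coeff_expand_of_not_dvd, smul_zero]
        rintro ⟨m, h⟩
        exact hm ⟨m, by omega⟩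
      · simp
  · rw [if_neg hn, ((isClass_X_pow 6).mul (isClass_expand _ (by norm_num) _)).smul _ n (by simpa)]

theorem two_smul_pentagonalSeries_pow_three :
    jacobiSeries = (2 : ℤ) • pentagonalSeries ℤ ^ 3 := by
  rw [jacobiSeries_eq, zsmul_eq_mul]
  simp

/-- The components of the Euler function in the classes `0`, `1`, `5` and (negated) `2`
modulo `7`, with the two relations that follow from Jacobi's identity. -/
theorem exists_seven_dissection :
    ∃ A B D : ℤ⟦X⟧, IsClass 0 A ∧ IsClass 1 B ∧ IsClass 5 D ∧
      pentagonalSeries ℤ = A + B + D - X ^ 2 * expand 49 (by norm_num) (pentagonalSeries ℤ) ∧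
      A * B * D = -(X ^ 2 * expand 49 (by norm_num) (pentagonalSeries ℤ)) ^ 3 ∧
      A * B ^ 2 - A ^ 2 * (X ^ 2 * expand 49 (by norm_num) (pentagonalSeries ℤ)) +
        D * (X ^ 2 * expand 49 (by norm_num) (pentagonalSeries ℤ)) ^ 2 = 0 := by
  set F : ℤ⟦X⟧ := X ^ 2 * expand 49 (by norm_num) (pentagonalSeries ℤ) with hF
  set A := residuePart 0 (pentagonalSeries ℤ) with hA
  set B := residuePart 1 (pentagonalSeries ℤ) with hB
  set D := residuePart 5 (pentagonalSeries ℤ) with hD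
  have cA : IsClass 0 A := isClass_residuePart _ _
  have cB : IsClass 1 B := isClass_residuePart _ _
  have cD : IsClass 5 D := isClass_residuePart _ _
  have cF : IsClass 2 F := by
    simpa using (isClass_X_pow 2).mul (isClass_expand (by norm_num) (by norm_num) _)
  have hE : pentagonalSeries ℤ = A + B + D - F := by
    have h2 : -F = residuePart 2 (pentagonalSeries ℤ) := by
      rw [residuePart_two_pentagonalSeries]
    rw [sub_eq_add_neg, h2]
    ext n
    simp only [hA, hB, hD, map_add, coeff_residuePart]
    have hc := @coeff_pentagonalSeries_of_zmod n
    generalize (n : ZMod 7) = x at hc ⊢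
    generalize coeff n (pentagonalSeries ℤ) = y at hc ⊢
    have hx : ∀ x : ZMod 7, x = 0 ∨ x = 1 ∨ x = 2 ∨ x = 3 ∨ x = 4 ∨ x = 5 ∨ x = 6 := by decide
    rcases hx x with rfl | rfl | rfl | rfl | rfl | rfl | rfl
    · simp +decide
    · simp +decide
    · simp +decide
    · rw [hc (by simp)]; simp
    · rw [hc (by simp)]; simp
    · simp +decide
    · rw [hc (by simp)]; simp
  -- All four exponents are kept, even when zero, so that each of the twenty monomials of the cube
  -- matches this form and its class is settled by `decide`.
  have hmono (s : ZMod 7) (i j k l : ℕ) : residuePart s (A ^ i * B ^ j * D ^ k * F ^ l) =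
      if (i * 0 + j * 1 + k * 5 + l * 2 : ZMod 7) = s then A ^ i * B ^ j * D ^ k * F ^ l else 0 :=
    ((((cA.pow i).mul (cB.pow j)).mul (cD.pow k)).mul (cF.pow l)).residuePart_eq s
  have hexp : pentagonalSeries ℤ ^ 3 = (-1 : ℤ) • (A ^ 0 * B ^ 0 * D ^ 0 * F ^ 3) + (3 : ℤ) • (A ^ 0 * B ^ 0 * D ^ 1 * F ^ 2) +
      (-3 : ℤ) • (A ^ 0 * B ^ 0 * D ^ 2 * F ^ 1) + (1 : ℤ) • (A ^ 0 * B ^ 0 * D ^ 3 * F ^ 0) +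
      (3 : ℤ) • (A ^ 0 * B ^ 1 * D ^ 0 * F ^ 2) + (-6 : ℤ) • (A ^ 0 * B ^ 1 * D ^ 1 * F ^ 1) +
      (3 : ℤ) • (A ^ 0 * B ^ 1 * D ^ 2 * F ^ 0) + (-3 : ℤ) • (A ^ 0 * B ^ 2 * D ^ 0 * F ^ 1) +
      (3 : ℤ) • (A ^ 0 * B ^ 2 * D ^ 1 * F ^ 0) + (1 : ℤ) • (A ^ 0 * B ^ 3 * D ^ 0 * F ^ 0) +
      (3 : ℤ) • (A ^ 1 * B ^ 0 * D ^ 0 * F ^ 2) + (-6 : ℤ) • (A ^ 1 * B ^ 0 * D ^ 1 * F ^ 1) +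
      (3 : ℤ) • (A ^ 1 * B ^ 0 * D ^ 2 * F ^ 0) + (-6 : ℤ) • (A ^ 1 * B ^ 1 * D ^ 0 * F ^ 1) +
      (6 : ℤ) • (A ^ 1 * B ^ 1 * D ^ 1 * F ^ 0) + (3 : ℤ) • (A ^ 1 * B ^ 2 * D ^ 0 * F ^ 0) +
      (-3 : ℤ) • (A ^ 2 * B ^ 0 * D ^ 0 * F ^ 1) + (3 : ℤ) • (A ^ 2 * B ^ 0 * D ^ 1 * F ^ 0) +
      (3 : ℤ) • (A ^ 2 * B ^ 1 * D ^ 0 * F ^ 0) + (1 : ℤ) • (A ^ 3 * B ^ 0 * D ^ 0 * F ^ 0) := by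
    rw [hE]
    simp only [zsmul_eq_mul]
    push_cast
    ring
  have hz : ∀ f : ℤ⟦X⟧, ∀ c : ℤ, c ≠ 0 → c • f = 0 → f = 0 := fun f c hc h ↦ by
    ext n
    have h1 := congrArg (coeff n) h
    rw [map_zsmul, map_zero, smul_eq_zero] at h1
    rw [map_zero, h1.resolve_left hc]
  have e2 : residuePart 2 (pentagonalSeries ℤ ^ 3) = 0 := by
    apply hz _ 2 (by norm_num)
    rw [← map_zsmul, ← two_smul_pentagonalSeries_pow_three, residuePart_two_jacobiSeries]
  have e6 : residuePart 6 (pentagonalSeries ℤ ^ 3) = (-7 : ℤ) • F ^ 3 := by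
    apply sub_eq_zero.mp
    apply hz _ 2 (by norm_num)
    rw [smul_sub, ← map_zsmul, ← two_smul_pentagonalSeries_pow_three, residuePart_six_jacobiSeries,
      two_smul_pentagonalSeries_pow_three, map_zsmul, map_pow, hF]
    simp only [zsmul_eq_mul]
    push_cast
    ring
  refine ⟨A, B, D, cA, cB, cD, hE, ?_, ?_⟩
  · rw [hexp] at e6
    simp only [map_add, map_zsmul, hmono] at e6
    simp +decide only [if_true, if_false, smul_zero, add_zero] at e6
    apply sub_eq_zero.mp
    -- The only monomials of class 6 are ABD and F^3, so 6ABD - F^3 = -7F^3.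
    apply hz _ 6 (by norm_num)
    simp only [zsmul_eq_mul] at e6 ⊢
    push_cast at e6 ⊢
    linear_combination e6
  · rw [hexp] at e2
    simp only [map_add, map_zsmul, hmono] at e2
    simp +decide only [if_true, if_false, smul_zero, zero_add, add_zero] at e2
    -- The only monomials of class 2 are AB², A²F and DF², with coefficients 3, -3 and 3.
    apply hz _ 3 (by norm_num)
    simp only [zsmul_eq_mul] at e2 ⊢
    push_cast at e2 ⊢
    linear_combination e2

/-! ### Newton's identities for the roots of a monic polynomial -/

section Newton

open Finset in
-- Both sides are monic of degree N and agree at the N distinct points r k.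
theorem prod_X_sub_C_eq_of_roots {R : Type*} [CommRing R] [IsDomain R] {N : ℕ} (r : Fin N → R)
    (hr : Function.Injective r) (c : ℕ → R)
    (h : ∀ k, r k ^ N = ∑ i ∈ range N, c i * r k ^ i) :
    ∏ k, (Polynomial.X - Polynomial.C (r k)) =
      Polynomial.X ^ N - ∑ i ∈ range N, Polynomial.C (c i) * Polynomial.X ^ i := by
  classical
  have hdeg : (∑ i ∈ range N, Polynomial.C (c i) * Polynomial.X ^ i).degree < (N : WithBot ℕ) := by
    refine Polynomial.mem_degreeLT.mp (Submodule.sum_mem _ fun i hi ↦ Polynomial.mem_degreeLT.mpr ?_)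
    exact (Polynomial.degree_C_mul_X_pow_le _ _).trans_lt (by exact_mod_cast mem_range.mp hi)
  have hm := Polynomial.monic_X_pow_sub hdeg
  have hdN : (Polynomial.X ^ N - ∑ i ∈ range N, Polynomial.C (c i) * Polynomial.X ^ i).degree
      = (N : WithBot ℕ) := by
    rw [Polynomial.degree_sub_eq_left_of_degree_lt, Polynomial.degree_X_pow]
    rwa [Polynomial.degree_X_pow]
  have hd1 : (∏ k, (Polynomial.X - Polynomial.C (r k))).degree = (N : WithBot ℕ) := by
    rw [Polynomial.degree_prod]
    simp
  refine Polynomial.eq_of_degree_sub_lt_of_eval_finset_eq (univ.image r) ?_ ?_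
  · rw [card_image_of_injective _ hr, card_univ, Fintype.card_fin]
    refine (Polynomial.degree_sub_lt_left (hd1.trans hdN.symm) ?_ ?_).trans_eq hd1
    · exact (Polynomial.monic_prod_of_monic _ _ fun k _ ↦ Polynomial.monic_X_sub_C _).ne_zero
    · rw [(Polynomial.monic_prod_of_monic _ _ fun k _ ↦ Polynomial.monic_X_sub_C _).leadingCoeff,
        hm.leadingCoeff]
  · intro x hx
    obtain ⟨k, -, rfl⟩ := mem_image.mp hx
    rw [Polynomial.eval_prod, prod_eq_zero (mem_univ k) (by simp), Polynomial.eval_sub,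
      Polynomial.eval_finsetSum]
    simp [h k]

open Finset in
/-- Product and power sums of the roots of `x^7 - c₆x^6 - ⋯ - c₀`. -/
theorem prod_and_power_sums_of_roots {R : Type*} [CommRing R] [IsDomain R] (r : Fin 7 → R)
    (hr : Function.Injective r) (c : ℕ → R)
    (h : ∀ k, r k ^ 7 = ∑ i ∈ range 7, c i * r k ^ i) (p : ℕ → R) (hp : ∀ i, p i = ∑ k, r k ^ i) :
    ∏ k, r k = c 0 ∧ p 1 = c 6 ∧ p 2 = c 6 * p 1 + 2 * c 5 ∧
      p 3 = c 6 * p 2 + c 5 * p 1 + 3 * c 4 ∧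
      p 4 = c 6 * p 3 + c 5 * p 2 + c 4 * p 1 + 4 * c 3 ∧
      p 5 = c 6 * p 4 + c 5 * p 3 + c 4 * p 2 + c 3 * p 1 + 5 * c 2 ∧
      p 6 = c 6 * p 5 + c 5 * p 4 + c 4 * p 3 + c 3 * p 2 + c 2 * p 1 + 6 * c 1 := by
  have hprod := prod_X_sub_C_eq_of_roots r hr c h
  have hcoeff (k : ℕ) (hk : k < 7) :
      (-1) ^ (7 - k) * MvPolynomial.aeval r (MvPolynomial.esymm (Fin 7) R (7 - k)) = -c k := by
    have h1 := Multiset.prod_X_sub_C_coeff (univ.val.map r) (k := k) (by simpa using hk.le)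
    have h2 : ((univ.val.map r).map fun t ↦ Polynomial.X - Polynomial.C t).prod =
        ∏ k, (Polynomial.X - Polynomial.C (r k)) := by
      rw [Multiset.map_map]; rfl
    rw [h2, hprod, Multiset.card_map, card_val, card_univ, Fintype.card_fin] at h1
    rw [MvPolynomial.aeval_esymm_eq_multiset_esymm, ← h1]
    simp only [Polynomial.coeff_sub, Polynomial.coeff_X_pow, Polynomial.finsetSum_coeff,
      Polynomial.coeff_C_mul_X_pow]
    rw [if_neg hk.ne, sum_ite_eq, if_pos (mem_range.mpr hk), zero_sub]
  have hpsum (i : ℕ) : MvPolynomial.aeval r (MvPolynomial.psum (Fin 7) R i) = p i := by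
    simp [MvPolynomial.psum, hp]
  have hN (i : ℕ) (hi : 0 < i) :=
    congrArg (MvPolynomial.aeval r) (MvPolynomial.psum_eq_mul_esymm_sub_sum (Fin 7) R i hi)
  have h0 : ∏ k, r k = c 0 := by
    have := congrArg (Polynomial.eval 0) hprod
    simp only [Polynomial.eval_prod, Polynomial.eval_sub, Polynomial.eval_X, Polynomial.eval_C,
      Polynomial.eval_pow, Polynomial.eval_mul, zero_sub, prod_neg,
      card_univ, Fintype.card_fin, sum_range_succ, sum_range_zero,
      Polynomial.eval_add] at this
    simp only [zero_pow, pow_zero, mul_zero, Polynomial.eval_zero, ne_eq, OfNat.ofNat_ne_zero,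
      one_ne_zero, not_false_eq_true] at this
    linear_combination -this
  simp only [map_sub, map_mul, map_sum, map_pow, map_neg, map_one, map_natCast, hpsum] at hN
  have e1 := hcoeff 6 (by norm_num)
  have e2 := hcoeff 5 (by norm_num)
  have e3 := hcoeff 4 (by norm_num)
  have e4 := hcoeff 3 (by norm_num)
  have e5 := hcoeff 2 (by norm_num)
  have e6 := hcoeff 1 (by norm_num)
  have n1 := hN 1 (by norm_num)
  have n2 := hN 2 (by norm_num)
  have n3 := hN 3 (by norm_num)
  have n4 := hN 4 (by norm_num)
  have n5 := hN 5 (by norm_num)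
  have n6 := hN 6 (by norm_num)
  have s1 : ((antidiagonal 1).filter fun a : ℕ × ℕ ↦ a.1 ∈ Set.Ioo 0 1) = ∅ := by
    ext ⟨a, b⟩; simp; omega
  have s2 : ((antidiagonal 2).filter fun a : ℕ × ℕ ↦ a.1 ∈ Set.Ioo 0 2) = {(1, 1)} := by
    ext ⟨a, b⟩; simp; omega
  have s3 : ((antidiagonal 3).filter fun a : ℕ × ℕ ↦ a.1 ∈ Set.Ioo 0 3) = {(1, 2), (2, 1)} := by
    ext ⟨a, b⟩; simp; omega
  have s4 : ((antidiagonal 4).filter fun a : ℕ × ℕ ↦ a.1 ∈ Set.Ioo 0 4) =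
      {(1, 3), (2, 2), (3, 1)} := by
    ext ⟨a, b⟩; simp; omega
  have s5 : ((antidiagonal 5).filter fun a : ℕ × ℕ ↦ a.1 ∈ Set.Ioo 0 5) =
      {(1, 4), (2, 3), (3, 2), (4, 1)} := by
    ext ⟨a, b⟩; simp; omega
  have s6 : ((antidiagonal 6).filter fun a : ℕ × ℕ ↦ a.1 ∈ Set.Ioo 0 6) =
      {(1, 5), (2, 4), (3, 3), (4, 2), (5, 1)} := by
    ext ⟨a, b⟩; simp; omega
  rw [s1] at n1
  rw [s2] at n2
  rw [s3] at n3
  rw [s4] at n4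
  rw [s5] at n5
  rw [s6] at n6
  norm_num at e1 e2 e3 e4 e5 e6 n1 n2 n3 n4 n5 n6
  rw [e1] at n1 n2 n3 n4 n5 n6
  rw [e2] at n2 n3 n4 n5 n6
  rw [e4] at n4 n5 n6
  rw [e6] at n6
  refine ⟨h0, n1, ?_, ?_, ?_, ?_, ?_⟩
  · rw [n2]; ring
  · linear_combination n3 + 3 * e3
  · linear_combination n4 + p 1 * e3
  · linear_combination n5 + p 2 * e3 + 5 * e5
  · linear_combination n6 + p 3 * e3 + p 1 * e5

end Newton

/-! ### The modular equation of level seven -/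

/-- The modular equation of level seven on the Klein quartic `a²b³ - a³b = 1`. -/
theorem modular_equation_klein {K : Type*} [CommRing K] {a b c : K} (hc : a * b ^ 2 - a ^ 2 + c = 0)
    (habc : a * b * c = -1) {W x : K} (hW : W = a ^ 3 * b + b ^ 3 * c + c ^ 3 * a + 8)
    (hx : x = a + b + c - 1) :
    W ^ 2 = x ^ 7 + 7 * x ^ 6 + 21 * x ^ 5 + 49 * x ^ 4 + 147 * x ^ 3 + 343 * x ^ 2 + 343 * x -
      W * (7 * x ^ 3 + 35 * x ^ 2 + 49 * x) := by
  -- The first relation eliminates c. The claim then holds modulo the remaining relation abc = -1, a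
  -- quartic in a/b-coordinates once c is gone; the long factor is the cofactor.
  have hc' : c = a ^ 2 - a * b ^ 2 := by linear_combination hc
  subst hc' hx hW
  linear_combination (exp := 1) (-1 : K) * (
      -9 - 28 * b ^ 1 - 42 * b ^ 2 + 14 * b ^ 4 + 1 * b ^ 7 - 28 * a ^ 1 - 84 * a ^ 1 * b ^ 1 +
      28 * a ^ 1 * b ^ 2 + 140 * a ^ 1 * b ^ 3 - 61 * a ^ 1 * b ^ 5 + 7 * a ^ 1 * b ^ 6 + 14 * a
      ^ 1 * b ^ 7 - 70 * a ^ 2 - 84 * a ^ 2 * b ^ 1 + 168 * a ^ 2 * b ^ 2 + 52 * a ^ 2 * b ^ 3 -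
      238 * a ^ 2 * b ^ 4 - 35 * a ^ 2 * b ^ 5 + 112 * a ^ 2 * b ^ 6 - 7 * a ^ 2 * b ^ 7 - 28 * a
      ^ 2 * b ^ 8 - 84 * a ^ 3 + 70 * a ^ 3 * b ^ 1 + 280 * a ^ 3 * b ^ 2 - 168 * a ^ 3 * b ^ 3 -
      252 * a ^ 3 * b ^ 4 + 217 * a ^ 3 * b ^ 5 + 112 * a ^ 3 * b ^ 6 - 84 * a ^ 3 * b ^ 7 + 3 *
      a ^ 3 * b ^ 8 + 21 * a ^ 3 * b ^ 9 - 28 * a ^ 4 + 196 * a ^ 4 * b ^ 1 + 84 * a ^ 4 * b ^ 2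
      - 434 * a ^ 4 * b ^ 3 - 56 * a ^ 4 * b ^ 4 + 280 * a ^ 4 * b ^ 5 - 73 * a ^ 4 * b ^ 6 - 98
      * a ^ 4 * b ^ 7 + 21 * a ^ 4 * b ^ 8 - 7 * a ^ 4 * b ^ 10 + 56 * a ^ 5 + 224 * a ^ 5 * b ^
      1 - 112 * a ^ 5 * b ^ 2 - 308 * a ^ 5 * b ^ 3 + 199 * a ^ 5 * b ^ 4 + 168 * a ^ 5 * b ^ 5 -
      84 * a ^ 5 * b ^ 6 + 35 * a ^ 5 * b ^ 8 + 1 * a ^ 5 * b ^ 11 + 84 * a ^ 6 + 112 * a ^ 6 * b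
      ^ 1 - 191 * a ^ 6 * b ^ 2 - 126 * a ^ 6 * b ^ 3 + 126 * a ^ 6 * b ^ 4 - 70 * a ^ 6 * b ^ 6
      - 5 * a ^ 6 * b ^ 9 + 62 * a ^ 7 + 35 * a ^ 7 * b ^ 1 - 84 * a ^ 7 * b ^ 2 + 70 * a ^ 7 * b
      ^ 4 + 10 * a ^ 7 * b ^ 7 + 21 * a ^ 8 - 35 * a ^ 8 * b ^ 2 - 10 * a ^ 8 * b ^ 5 + 7 * a ^ 9
      + 5 * a ^ 9 * b ^ 3 - 1 * a ^ 10 * b ^ 1) *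
      habc

/-- `q² E(q⁴⁹) / E(q)`. -/
noncomputable def eulerQuotient : ℤ⟦X⟧ :=
  X ^ 2 * expand 49 (by norm_num) (pentagonalSeries ℤ) * eulerInv

theorem exists_coeff_one_eq_of_isClass_one {f : ℤ⟦X⟧} {r : ZMod 7} (h : IsClass r f) (hr : r ≠ 0) :
    ∃ g, f = X * g := by
  apply X_dvd_iff.mpr
  rw [← coeff_zero_eq_constantCoeff_apply]
  exact h 0 (by simpa using hr.symm)

theorem coeff_one_pentagonalSeries : coeff 1 (pentagonalSeries ℤ) = -1 := by
  simpa [pentagonal] using coeff_pentagonalSeries_pentagonal ℤ 1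

/-- The modular equation of level seven, up to the identification of `V`. -/
theorem exists_modular_equation :
    ∃ S T V : ℤ⟦X⟧, IsClass 1 S ∧ S = X * T ∧ constantCoeff T = -1 ∧
      V * T = X ^ 7 * expand 49 (by norm_num) (pentagonalSeries ℤ) ^ 4 ∧
      eulerQuotient ^ 7 = V ^ 2 * (1 + 7 * eulerQuotient + 21 * eulerQuotient ^ 2 +
        49 * eulerQuotient ^ 3 + 147 * eulerQuotient ^ 4 + 343 * eulerQuotient ^ 5 +
        343 * eulerQuotient ^ 6) -
        V * (7 * eulerQuotient ^ 4 + 35 * eulerQuotient ^ 5 + 49 * eulerQuotient ^ 6) := by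
  obtain ⟨A, B, D, cA, cB, cD, hE, hABD, hrel⟩ := exists_seven_dissection
  have hw : eulerQuotient =
    X ^ 2 * expand 49 (by norm_num) (pentagonalSeries ℤ) * eulerInv := rfl
  have hP := pentagonalSeries_mul_eulerInv
  have cF : IsClass 2 (X ^ 2 * expand 49 (by norm_num) (pentagonalSeries ℤ)) := by
    simpa using (isClass_X_pow 2).mul (isClass_expand (by norm_num) (by norm_num) _)
  have hF0 : X ^ 2 * expand 49 (by norm_num) (pentagonalSeries ℤ) ≠ 0 := by
    apply mul_ne_zero (pow_ne_zero _ X_ne_zero)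
    rw [Ne, ← order_eq_top, order_expand]
    have h0 : (pentagonalSeries ℤ).order = 0 := by
      apply order_zero_of_unit
      rw [isUnit_iff_constantCoeff, constantCoeff_pentagonalSeries]
      exact isUnit_one
    rw [h0]
    simp
  set E := pentagonalSeries ℤ with hEdef
  set Q := expand 49 (by norm_num) E with hQ
  set F := X ^ 2 * Q with hF
  -- In degree 4 every term has class 1, as does F^4; the quotient of this form by F^4 therefore has
  -- exponents divisible by 7, which is what makes it a parameter in q^7.
  have hS : IsClass 1 (A ^ 3 * B + B ^ 3 * D + D ^ 3 * A + (8 : ℤ) • F ^ 4) :=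
    ((((cA.pow 3).mul cB).add ((cB.pow 3).mul cD)).add ((cD.pow 3).mul cA)).add ((cF.pow 4).smul 8)
  obtain ⟨B', hB'⟩ := exists_coeff_one_eq_of_isClass_one cB (by decide)
  obtain ⟨D', hD'⟩ := exists_coeff_one_eq_of_isClass_one cD (by decide)
  set T := A ^ 3 * B' + X ^ 3 * B' ^ 3 * D' + X ^ 2 * D' ^ 3 * A + 8 * X ^ 7 * Q ^ 4 with hT
  have hST : A ^ 3 * B + B ^ 3 * D + D ^ 3 * A + (8 : ℤ) • F ^ 4 = X * T := by
    rw [hB', hD', hT, hF, zsmul_eq_mul]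
    push_cast
    ring
  have hA0 : constantCoeff A = 1 := by
    have := congrArg constantCoeff hE
    rw [hEdef, constantCoeff_pentagonalSeries, hB', hD', hF] at this
    simpa using this.symm
  have hA1 : coeff 1 A = 0 := cA 1 (by decide)
  have hD1 : coeff 1 D = 0 := cD 1 (by decide)
  have hF1 : coeff 1 F = 0 := cF 1 (by decide)
  have hB1 : constantCoeff B' = -1 := by
    have := congrArg (coeff 1) hE
    rw [map_sub, map_add, map_add, hA1, hD1, hF1, hB', hEdef, coeff_one_pentagonalSeries,
      show 1 = 0 + 1 from rfl, coeff_succ_X_mul, coeff_zero_eq_constantCoeff_apply] at this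
    linarith
  have hT0 : constantCoeff T = -1 := by
    simp [hT, hA0, hB1]
  -- T has constant term -1, so V = F^4/S = X^7 Q^4/T exists over ℤ; it is the reciprocal of the W
  -- of the Klein identity.
  have hTinv : T * invOfUnit T (-1) = 1 := mul_invOfUnit _ _ (by simp [hT0])
  have hVT : X ^ 7 * Q ^ 4 * invOfUnit T (-1) * T = X ^ 7 * Q ^ 4 := by
    linear_combination X ^ 7 * Q ^ 4 * hTinv
  refine ⟨_, T, X ^ 7 * Q ^ 4 * invOfUnit T (-1), hS, hST, hT0, hVT, ?_⟩
  rw [hST] at hS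
  set V := X ^ 7 * Q ^ 4 * invOfUnit T (-1)
  have hpoly : (X * T) ^ 2 = F * (E ^ 7 + 7 * E ^ 6 * F + 21 * E ^ 5 * F ^ 2 + 49 * E ^ 4 * F ^ 3 +
      147 * E ^ 3 * F ^ 4 + 343 * E ^ 2 * F ^ 5 + 343 * E * F ^ 6) -
      X * T * (7 * E ^ 3 * F + 35 * E ^ 2 * F ^ 2 + 49 * E * F ^ 3) := by
    -- Dividing by F in the fraction field turns the two relations of the dissection into the affine
    -- ones, with x = E/F = 1/w.
    have hinj := IsFractionRing.injective ℤ⟦X⟧ (FractionRing ℤ⟦X⟧)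
    set φ := algebraMap ℤ⟦X⟧ (FractionRing ℤ⟦X⟧)
    have hφ : φ F ≠ 0 := by
      rw [Ne, map_eq_zero_iff φ hinj]
      exact hF0
    have e1 : φ A / φ F * (φ B / φ F) ^ 2 - (φ A / φ F) ^ 2 + φ D / φ F = 0 := by
      have := congrArg φ hrel
      simp only [map_add, map_sub, map_mul, map_pow, map_zero] at this
      field_simp
      linear_combination this
    have e2 : φ A / φ F * (φ B / φ F) * (φ D / φ F) = -1 := by
      have := congrArg φ hABD
      simp only [map_neg, map_mul, map_pow] at this
      field_simp
      linear_combination this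
    have e3 : φ (X * T) / φ F ^ 4 = (φ A / φ F) ^ 3 * (φ B / φ F) + (φ B / φ F) ^ 3 * (φ D / φ F) +
        (φ D / φ F) ^ 3 * (φ A / φ F) + 8 := by
      rw [← hST, zsmul_eq_mul]
      simp only [map_add, map_mul, map_pow, map_intCast]
      field_simp
      push_cast
      ring
    have e4 : φ E / φ F = φ A / φ F + φ B / φ F + φ D / φ F - 1 := by
      rw [hE]
      simp only [map_add, map_sub]
      field_simp
    have e5 := modular_equation_klein e1 e2 e3 e4
    apply hinj
    simp only [map_add, map_sub, map_mul, map_pow, map_ofNat] at e5 ⊢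
    field_simp at e5
    linear_combination e5
  have hVS : V * (X * T) = F ^ 4 := by
    rw [hF]
    linear_combination X * hVT
  have hwE : eulerQuotient * E = F := by
    rw [hw]
    linear_combination F * hP
  have hFw : F * eulerInv = eulerQuotient := hw.symm
  apply mul_left_cancel₀ hF0
  have h8 : F ^ 8 = V ^ 2 * (X * T) ^ 2 := by rw [← mul_pow, hVS]; ring
  rw [hpoly] at h8
  have hk (k : ℕ) : E ^ k * eulerInv ^ k = 1 := by rw [← mul_pow, hP, one_pow]
  rw [← hFw]
  linear_combination eulerInv ^ 7 * h8 + V ^ 2 * F * (hk 7 + 7 * F * eulerInv * hk 6 +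
    21 * F ^ 2 * eulerInv ^ 2 * hk 5 + 49 * F ^ 3 * eulerInv ^ 3 * hk 4 +
    147 * F ^ 4 * eulerInv ^ 4 * hk 3 + 343 * F ^ 5 * eulerInv ^ 5 * hk 2 +
    343 * F ^ 6 * eulerInv ^ 6 * hk 1) -
    V * (7 * E ^ 3 * F + 35 * E ^ 2 * F ^ 2 + 49 * E * F ^ 3) * eulerInv ^ 7 * hVS -
    V * F ^ 5 * (7 * eulerInv ^ 4 * hk 3 + 35 * F * eulerInv ^ 5 * hk 2 +
      49 * F ^ 2 * eulerInv ^ 6 * hk 1)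

/-! ### The norm of the Euler function under q ↦ ζq -/

section Norm

variable {ζ : ℂ}

theorem prod_one_sub_zeta_mul {η : ℂ} (hη : IsPrimitiveRoot η 7) {y : ℂ⟦X⟧} (hy : y ≠ 0) :
    ∏ k : Fin 7, (1 - C (η ^ (k : ℕ)) * y) = 1 - y ^ 7 := by
  have hinj : Function.Injective fun k : Fin 7 ↦ C (η ^ (k : ℕ)) * y := by
    intro i j hij
    exact Fin.ext (hη.pow_inj i.2 j.2 (C_injective (mul_right_cancel₀ hy hij)))
  have h := prod_X_sub_C_eq_of_roots _ hinj (fun i ↦ if i = 0 then y ^ 7 else 0) (by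
    intro k
    rw [Finset.sum_eq_single 0]
    · rw [mul_pow, ← map_pow, ← pow_mul, mul_comm _ 7, pow_mul, hη.pow_eq_one]
      simp
    · intro i _ hi
      simp [hi]
    · simp)
  have h1 := congrArg (Polynomial.eval 1) h
  rw [Polynomial.eval_prod, Finset.sum_eq_single 0] at h1
  · simpa using h1
  · intro i _ hi
    simp [hi]
  · simp

theorem sum_zeta_pow (hζ : IsPrimitiveRoot ζ 7) (n : ℕ) :
    ∑ k : Fin 7, (ζ ^ (k : ℕ)) ^ n = if 7 ∣ n then 7 else 0 := by
  rw [Fin.sum_univ_eq_sum_range (fun k ↦ (ζ ^ k) ^ n) 7]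
  simp_rw [← pow_mul, mul_comm _ n, pow_mul]
  split_ifs with h
  · rw [(hζ.pow_eq_one_iff_dvd n).mpr h]
    simp
  · have h1 : ζ ^ n ≠ 1 := fun h' ↦ h ((hζ.pow_eq_one_iff_dvd n).mp h')
    rw [geom_sum_eq h1, ← pow_mul, mul_comm, pow_mul, hζ.pow_eq_one]
    simp

theorem rescale_X_pow (c : ℂ) (n : ℕ) : rescale c (X ^ n) = C (c ^ n) * X ^ n := by
  rw [map_pow, rescale_X, mul_pow, map_pow]

theorem HasProd.powerSeries_rescale {f : ℕ → ℂ⟦X⟧} {a : ℂ⟦X⟧} (h : HasProd f a) (c : ℂ) :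
    HasProd (fun n ↦ rescale c (f n)) (rescale c a) := by
  refine h.map (rescale c) (continuous_iff_continuousAt.mpr fun x ↦ ?_)
  refine (WithPiTopology.tendsto_iff_coeff_tendsto ℂ _ _ _).mpr fun d ↦ ?_
  simp only [coeff_rescale]
  exact ((WithPiTopology.continuous_coeff ℂ d).const_mul _).continuousAt

theorem HasProd.powerSeries_expand {R : Type*} [CommRing R] [TopologicalSpace R] {f : ℕ → R⟦X⟧}
    {a : R⟦X⟧} (h : HasProd f a) {p : ℕ} (hp : p ≠ 0) :
    HasProd (fun n ↦ expand p hp (f n)) (expand p hp a) := by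
  refine h.map (expand p hp) (continuous_iff_continuousAt.mpr fun x ↦ ?_)
  refine (WithPiTopology.tendsto_iff_coeff_tendsto R _ _ _).mpr fun d ↦ ?_
  simp only [coeff_expand]
  split_ifs
  · exact (WithPiTopology.continuous_coeff R _).continuousAt
  · exact tendsto_const_nhds

theorem hasProd_expand_pentagonalSeries {R : Type*} [CommRing R] [TopologicalSpace R] {p : ℕ}
    (hp : p ≠ 0) :
    HasProd (fun n : ℕ ↦ (1 - X ^ (p * (n + 1)) : R⟦X⟧)) (expand p hp (pentagonalSeries R)) := by
  have h := (WithPiTopology.hasProd_one_sub_X_pow R).powerSeries_expand hp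
  simpa only [map_sub, map_one, map_pow, expand_X, ← pow_mul] using h

/-- Spreads a product over the multiples of p along all n, so that infinite products can be compared
factor by factor. -/
theorem hasProd_ite_dvd {R : Type*} [CommRing R] [TopologicalSpace R] {p : ℕ} (hp : p ≠ 0)
    {f : ℕ → R⟦X⟧} {a : R⟦X⟧} (h : HasProd (fun j ↦ f (p * (j + 1))) a) :
    HasProd (fun n : ℕ ↦ if p ∣ n + 1 then f (n + 1) else 1) a := by
  have hsub (j : ℕ) : p * (j + 1) - 1 + 1 = p * (j + 1) :=
    Nat.sub_add_cancel (Nat.mul_pos (Nat.pos_of_ne_zero hp) j.succ_pos)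
  have hinj : Function.Injective fun j : ℕ ↦ p * (j + 1) - 1 := fun a b h ↦ by
    have h1 : p * (a + 1) = p * (b + 1) := by
      rw [← hsub a, ← hsub b]
      exact congrArg (· + 1) h
    exact Nat.succ_injective (Nat.eq_of_mul_eq_mul_left (Nat.pos_of_ne_zero hp) h1)
  rw [← hinj.hasProd_iff]
  · convert h using 2 with j
    rw [Function.comp_apply, hsub, if_pos (dvd_mul_right _ _)]
  · intro n hn
    rw [if_neg]
    rintro ⟨j, hj⟩
    obtain ⟨i, rfl⟩ : ∃ i, j = i + 1 := Nat.exists_eq_succ_of_ne_zero (by rintro rfl; simp at hj)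
    exact hn ⟨i, by dsimp only; omega⟩

/-- The norm of the Euler function from `q` to `q⁷`. -/
theorem prod_rescale_pentagonalSeries (hζ : IsPrimitiveRoot ζ 7) :
    (∏ k : Fin 7, rescale (ζ ^ (k : ℕ)) (pentagonalSeries ℂ)) *
      expand 49 (by norm_num) (pentagonalSeries ℂ) =
      expand 7 (by norm_num) (pentagonalSeries ℂ) ^ 8 := by
  have h1 := hasProd_prod (s := Finset.univ) fun (k : Fin 7) _ ↦
    (WithPiTopology.hasProd_one_sub_X_pow ℂ).powerSeries_rescale (ζ ^ (k : ℕ))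
  have h49 : HasProd (fun j : ℕ ↦ (1 - X ^ (7 * (7 * (j + 1))) : ℂ⟦X⟧))
      (expand 49 (by norm_num) (pentagonalSeries ℂ)) := by
    simpa only [← mul_assoc, show 7 * 7 = 49 from rfl] using
      hasProd_expand_pentagonalSeries (R := ℂ) (p := 49) (by norm_num)
  have h2 := hasProd_ite_dvd (p := 7) (by norm_num) (f := fun n ↦ (1 - X ^ (7 * n) : ℂ⟦X⟧)) h49
  have h3 := hasProd_expand_pentagonalSeries (R := ℂ) (p := 7) (by norm_num)
  have h4 := hasProd_prod (s := Finset.univ) fun (_ : Fin 7) _ ↦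
    hasProd_ite_dvd (p := 7) (by norm_num) (f := fun n ↦ (1 - X ^ n : ℂ⟦X⟧)) h3
  have h5 := h1.mul h2
  have h6 := h3.mul h4
  rw [Finset.prod_const, Finset.card_univ, Fintype.card_fin, ← pow_succ'] at h6
  refine h5.unique ?_
  convert h6 using 2 with n
  simp only [map_sub, map_one, rescale_X_pow, Finset.prod_const, Finset.card_univ,
    Fintype.card_fin]
  -- With m = n + 1, both sides have the factor (1 - q^m)^7 (1 - q^(7m)) if 7 divides m. Otherwise
  -- ζ^m is again primitive and both have 1 - q^(7m).
  by_cases hn : 7 ∣ n + 1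
  · simp only [if_pos hn]
    have hz (k : Fin 7) : (ζ ^ (k : ℕ)) ^ (n + 1) = 1 := by
      obtain ⟨j, hj⟩ := hn
      rw [hj, ← pow_mul, mul_left_comm, pow_mul, hζ.pow_eq_one, one_pow]
    simp only [hz, map_one, one_mul, Finset.prod_const, Finset.card_univ, Fintype.card_fin]
    ring
  · simp only [if_neg hn, one_pow, mul_one]
    have hη : IsPrimitiveRoot (ζ ^ (n + 1)) 7 :=
      hζ.pow_of_coprime _ ((Nat.Prime.coprime_iff_not_dvd (by norm_num)).mpr hn).symm
    rw [mul_comm 7, pow_mul, ← prod_one_sub_zeta_mul hη (pow_ne_zero _ X_ne_zero)]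
    refine Finset.prod_congr rfl fun k _ ↦ ?_
    rw [← pow_mul, ← pow_mul, mul_comm (k : ℕ)]

end Norm

/-! ### Conjugates, the operator U and the Hauptmodul -/

theorem map_pentagonalSeries {R S : Type*} [CommRing R] [CommRing S] (f : R →+* S) :
    PowerSeries.map f (pentagonalSeries R) = pentagonalSeries S := by
  ext n
  rw [coeff_map]
  by_cases hn : n ∈ Set.range pentagonal
  · obtain ⟨k, rfl⟩ := hn
    simp
  · rw [coeff_pentagonalSeries_eq_zero R hn, coeff_pentagonalSeries_eq_zero S hn, map_zero]

/-- The conjugate of a power series under `q ↦ ζ q`. -/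
noncomputable def conjugate (ζ : ℂ) : ℤ⟦X⟧ →+* ℂ⟦X⟧ :=
  (rescale ζ).comp (PowerSeries.map (Int.castRingHom ℂ))

theorem coeff_conjugate (ζ : ℂ) (f : ℤ⟦X⟧) (n : ℕ) :
    coeff n (conjugate ζ f) = ζ ^ n * ((coeff n f : ℤ) : ℂ) := by
  simp [conjugate, coeff_rescale]

theorem IsClass.conjugate_eq {r : ℕ} {f : ℤ⟦X⟧} (h : IsClass r f) {ζ : ℂ} (hζ : ζ ^ 7 = 1) :
    conjugate ζ f = C (ζ ^ r) * PowerSeries.map (Int.castRingHom ℂ) f := by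
  ext n
  rw [coeff_conjugate, coeff_C_mul, coeff_map, Int.coe_castRingHom]
  by_cases hn : (n : ZMod 7) = r
  · rw [pow_eq_pow_mod n hζ, pow_eq_pow_mod r hζ, (ZMod.natCast_eq_natCast_iff' n r 7).mp hn]
  · simp [h n hn]

/-- Extraction of the exponents divisible by `7`. -/
noncomputable def huffU : ℤ⟦X⟧ →+ ℤ⟦X⟧ where
  toFun f := mk fun n ↦ coeff (7 * n) f
  map_add' f g := by ext n; simp
  map_zero' := by ext n; simp

theorem coeff_huffU (f : ℤ⟦X⟧) (n : ℕ) : coeff n (huffU f) = coeff (7 * n) f :=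
  coeff_mk n fun n ↦ coeff (7 * n) f

/-- The trace from q to q^7: averaging over the seventh roots of unity kills all other exponents. It
turns power sums of conjugates into values of U. -/
theorem sum_conjugate {ζ : ℂ} (hζ : IsPrimitiveRoot ζ 7) (f : ℤ⟦X⟧) :
    ∑ k : Fin 7, conjugate (ζ ^ (k : ℕ)) f =
      PowerSeries.map (Int.castRingHom ℂ) (7 * expand 7 (by norm_num) (huffU f)) := by
  ext n
  rw [map_sum]
  simp only [coeff_conjugate]
  rw [← Finset.sum_mul, sum_zeta_pow hζ, coeff_map, show (7 : ℤ⟦X⟧) = C 7 by simp, coeff_C_mul,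
    coeff_expand]
  split_ifs with h
  · rw [coeff_huffU, Nat.mul_div_cancel' h]
    simp
  · simp

/-- The Hauptmodul `q (E(q⁷) / E(q))⁴` of level seven. -/
noncomputable def hauptmodul : ℤ⟦X⟧ :=
  X * expand 7 (by norm_num) (pentagonalSeries ℤ) ^ 4 * eulerInv ^ 4

theorem map_intCast_injective :
    Function.Injective (PowerSeries.map (Int.castRingHom ℂ)) :=
  map_injective _ (RingHom.injective_int _)

theorem expand_pentagonalSeries_mul_eulerInv {p : ℕ} (hp : p ≠ 0) :
    expand p hp (pentagonalSeries ℤ) * expand p hp eulerInv = 1 := by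
  rw [← map_mul, pentagonalSeries_mul_eulerInv, map_one]

theorem expand_seven_expand_seven (f : ℤ⟦X⟧) :
    expand 7 (by norm_num) (expand 7 (by norm_num) f) = expand 49 (by norm_num) f :=
  (expand_mul 7 (by norm_num) 7 (by norm_num) f).symm

theorem expand_hauptmodul : expand 7 (by norm_num) hauptmodul =
    X ^ 7 * expand 49 (by norm_num) (pentagonalSeries ℤ) ^ 4 *
      expand 7 (by norm_num) eulerInv ^ 4 := by
  rw [hauptmodul, map_mul, map_mul, map_pow, map_pow, expand_X, expand_seven_expand_seven]

theorem conjugate_pentagonalSeries (ζ : ℂ) :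
    conjugate ζ (pentagonalSeries ℤ) = rescale ζ (pentagonalSeries ℂ) := by
  rw [conjugate, RingHom.comp_apply, map_pentagonalSeries]

theorem eulerQuotient_mul_pentagonalSeries : eulerQuotient * pentagonalSeries ℤ =
    X ^ 2 * expand 49 (by norm_num) (pentagonalSeries ℤ) := by
  rw [eulerQuotient]
  linear_combination X ^ 2 * expand 49 (by norm_num) (pentagonalSeries ℤ) *
    pentagonalSeries_mul_eulerInv

/-- The norm of E gives the norm of w as q^14 E(q^49)^8/E(q^7)^8, the square of t(q^7). -/
theorem prod_conjugate_eulerQuotient {ζ : ℂ} (hζ : IsPrimitiveRoot ζ 7) :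
    ∏ k : Fin 7, conjugate (ζ ^ (k : ℕ)) eulerQuotient =
      PowerSeries.map (Int.castRingHom ℂ) (expand 7 (by norm_num) hauptmodul ^ 2) := by
  set φ := PowerSeries.map (Int.castRingHom ℂ) with hφ
  have hζk (k : Fin 7) : (ζ ^ (k : ℕ)) ^ 7 = 1 := by
    rw [← pow_mul, mul_comm, pow_mul, hζ.pow_eq_one, one_pow]
  have h1 (k : Fin 7) : conjugate (ζ ^ (k : ℕ)) eulerQuotient *
      rescale (ζ ^ (k : ℕ)) (pentagonalSeries ℂ) =
      C ((ζ ^ (k : ℕ)) ^ 2) * (X ^ 2 * expand 49 (by norm_num) (pentagonalSeries ℂ)) := by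
    have cF : IsClass ((2 : ℕ) : ZMod 7)
        (X ^ 2 * expand 49 (by norm_num) (pentagonalSeries ℤ)) := by
      simpa using (isClass_X_pow 2).mul (isClass_expand (by norm_num) (by norm_num) _)
    rw [← conjugate_pentagonalSeries, ← map_mul, eulerQuotient_mul_pentagonalSeries,
      cF.conjugate_eq (hζk k)]
    congr 1
    rw [map_mul, map_pow, map_X, map_expand, map_pentagonalSeries]
  have h2 := Finset.prod_congr (rfl : (Finset.univ : Finset (Fin 7)) = _) fun k _ ↦ h1 k
  -- The exponents add up to 2(0 + ⋯ + 6) = 42, a multiple of 7.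
  have h3 : ∏ k : Fin 7, (C ((ζ ^ (k : ℕ)) ^ 2) : ℂ⟦X⟧) = 1 := by
    rw [← map_prod, Finset.prod_pow, Fin.prod_univ_eq_prod_range (fun k ↦ ζ ^ k) 7,
      Finset.prod_pow_eq_pow_sum, ← pow_mul, show (∑ i ∈ Finset.range 7, i) * 2 = 7 * 6 from rfl,
      pow_mul, hζ.pow_eq_one, one_pow, map_one]
  rw [Finset.prod_mul_distrib, Finset.prod_mul_distrib, h3, one_mul, Finset.prod_const,
    Finset.card_univ, Fintype.card_fin] at h2
  have h4 := prod_rescale_pentagonalSeries hζ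
  have h5 := congrArg φ (expand_pentagonalSeries_mul_eulerInv (p := 7) (by norm_num))
  rw [map_mul, map_one, hφ, map_expand, map_pentagonalSeries, ← hφ] at h5
  have h6 : expand 7 (by norm_num) (pentagonalSeries ℂ) ^ 8 *
      φ (expand 7 (by norm_num) eulerInv) ^ 8 = 1 := by rw [← mul_pow, h5, one_pow]
  rw [expand_hauptmodul, map_pow, map_mul, map_mul, map_pow, map_pow, map_pow, hφ, map_X,
    map_expand _ _ _ (pentagonalSeries ℤ), map_pentagonalSeries, ← hφ]
  generalize expand 49 (by norm_num) (pentagonalSeries ℂ) = Q at *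
  generalize expand 7 (by norm_num) (pentagonalSeries ℂ) = E7 at *
  generalize φ (expand 7 (by norm_num) eulerInv) = P7 at *
  generalize (∏ k : Fin 7, conjugate (ζ ^ (k : ℕ)) eulerQuotient) = w at *
  generalize (∏ k : Fin 7, rescale (ζ ^ (k : ℕ)) (pentagonalSeries ℂ)) = N at *
  linear_combination Q * P7 ^ 8 * h2 - w * P7 ^ 8 * h4 - w * h6

theorem expand_injective {p : ℕ} (hp : p ≠ 0) :
    Function.Injective (expand p hp : ℤ⟦X⟧ → ℤ⟦X⟧) := by
  intro f g h
  ext n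
  rw [← coeff_expand_mul p hp, h, coeff_expand_mul]

theorem eq_of_map_seven_mul_expand {f g : ℤ⟦X⟧}
    (h : PowerSeries.map (Int.castRingHom ℂ) (7 * expand 7 (by norm_num) f) =
      PowerSeries.map (Int.castRingHom ℂ) (7 * expand 7 (by norm_num) g)) : f = g := by
  apply expand_injective (p := 7) (by norm_num)
  ext n
  have h1 := congrArg (coeff n) (map_intCast_injective h)
  rw [show (7 : ℤ⟦X⟧) = C 7 by simp, coeff_C_mul, coeff_C_mul] at h1
  omega

theorem coeff_two_eulerQuotient : coeff 2 eulerQuotient = 1 := by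
  rw [eulerQuotient, mul_assoc, show 2 = 0 + 2 from rfl, coeff_X_pow_mul,
    coeff_zero_eq_constantCoeff_apply, map_mul, constantCoeff_expand,
    constantCoeff_pentagonalSeries, constantCoeff_eulerInv, one_mul]

/-- The modular equation of level seven, with Newton's identities for its roots. -/
theorem eulerQuotient_pow_seven_and_newton {t t7 w : ℤ⟦X⟧} (ht : t = hauptmodul)
    (ht7 : t7 = expand 7 (by norm_num) t) (hw : w = eulerQuotient) :
    w ^ 7 = t7 ^ 2 * (1 + 7 * w + 21 * w ^ 2 + 49 * w ^ 3 + 147 * w ^ 4 + 343 * w ^ 5 +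
        343 * w ^ 6) + t7 * (7 * w ^ 4 + 35 * w ^ 5 + 49 * w ^ 6) ∧
      huffU w = 49 * t ^ 2 + 7 * t ∧
      huffU (w ^ 2) = (343 * t ^ 2 + 49 * t) * huffU w + (98 * t ^ 2 + 10 * t) ∧
      huffU (w ^ 3) = (343 * t ^ 2 + 49 * t) * huffU (w ^ 2) +
        (343 * t ^ 2 + 35 * t) * huffU w + (63 * t ^ 2 + 3 * t) ∧
      huffU (w ^ 4) = (343 * t ^ 2 + 49 * t) * huffU (w ^ 3) +
        (343 * t ^ 2 + 35 * t) * huffU (w ^ 2) + (147 * t ^ 2 + 7 * t) * huffU w + 28 * t ^ 2 ∧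
      huffU (w ^ 5) = (343 * t ^ 2 + 49 * t) * huffU (w ^ 4) +
        (343 * t ^ 2 + 35 * t) * huffU (w ^ 3) + (147 * t ^ 2 + 7 * t) * huffU (w ^ 2) +
        49 * t ^ 2 * huffU w + 15 * t ^ 2 ∧
      huffU (w ^ 6) = (343 * t ^ 2 + 49 * t) * huffU (w ^ 5) +
        (343 * t ^ 2 + 35 * t) * huffU (w ^ 4) + (147 * t ^ 2 + 7 * t) * huffU (w ^ 3) +
        49 * t ^ 2 * huffU (w ^ 2) + 21 * t ^ 2 * huffU w + 6 * t ^ 2 := by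
  obtain ⟨S, T, V, cS, hST, hT0, hVT, hmod⟩ := exists_modular_equation
  obtain ⟨ζ, hζ⟩ : ∃ ζ : ℂ, IsPrimitiveRoot ζ 7 := ⟨_, Complex.isPrimitiveRoot_exp 7 (by norm_num)⟩
  rw [← hw] at hmod
  set φ := PowerSeries.map (Int.castRingHom ℂ) with hφ
  have hφinj : Function.Injective φ := map_intCast_injective
  have hζk (k : Fin 7) : (ζ ^ (k : ℕ)) ^ 7 = 1 := by
    rw [← pow_mul, mul_comm, pow_mul, hζ.pow_eq_one, one_pow]
  -- VS and S both have class 1, so V is fixed by q ↦ ζq; hence all conjugates of w satisfy the same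
  -- polynomial.
  have hVconj (k : Fin 7) : conjugate (ζ ^ (k : ℕ)) V = φ V := by
    have hVS : V * S = X ^ 8 * expand 49 (by norm_num) (pentagonalSeries ℤ) ^ 4 := by
      rw [hST]
      linear_combination X * hVT
    have c1 : IsClass ((1 : ℕ) : ZMod 7)
        (X ^ 8 * expand 49 (by norm_num) (pentagonalSeries ℤ) ^ 4) := by
      have := (isClass_X_pow 8).mul
        ((isClass_expand (by norm_num) (by norm_num : 7 ∣ 49) (pentagonalSeries ℤ)).pow 4)
      convert this using 1
      decide
    have cS' : IsClass ((1 : ℕ) : ZMod 7) S := by simpa using cS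
    have h1 := congrArg (conjugate (ζ ^ (k : ℕ))) hVS
    rw [map_mul, c1.conjugate_eq (hζk k), cS'.conjugate_eq (hζk k), ← hVS, map_mul] at h1
    have hS0 : φ S ≠ 0 := by
      rw [Ne, map_eq_zero_iff φ hφinj, hST]
      apply mul_ne_zero X_ne_zero
      intro h0
      simp [h0] at hT0
    have hC : (C ((ζ ^ (k : ℕ)) ^ 1) : ℂ⟦X⟧) ≠ 0 := by
      rw [Ne, map_eq_zero_iff _ C_injective]
      exact pow_ne_zero _ (pow_ne_zero _ (hζ.ne_zero (by norm_num)))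
    apply mul_right_cancel₀ (mul_ne_zero hC hS0)
    linear_combination h1
  set r : Fin 7 → ℂ⟦X⟧ := fun k ↦ conjugate (ζ ^ (k : ℕ)) w with hr
  have hinj : Function.Injective r := by
    intro i j hij
    -- The leading term q² of w becomes ζ^(2k) q², which separates the conjugates.
    have h1 := congrArg (coeff 2) hij
    simp only [hr, coeff_conjugate, hw, coeff_two_eulerQuotient, Int.cast_one, mul_one] at h1
    rw [← pow_mul, ← pow_mul, mul_comm, mul_comm (j : ℕ), pow_mul, pow_mul] at h1
    exact Fin.ext ((hζ.pow_of_coprime 2 (by norm_num)).pow_inj i.2 j.2 h1)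
  set c : ℕ → ℂ⟦X⟧ := fun i ↦ if i = 0 then φ V ^ 2 else if i = 1 then 7 * φ V ^ 2 else
    if i = 2 then 21 * φ V ^ 2 else if i = 3 then 49 * φ V ^ 2 else
    if i = 4 then 147 * φ V ^ 2 - 7 * φ V else if i = 5 then 343 * φ V ^ 2 - 35 * φ V else
    343 * φ V ^ 2 - 49 * φ V with hc
  have hroot (k : Fin 7) : r k ^ 7 = ∑ i ∈ Finset.range 7, c i * r k ^ i := by
    have h1 := congrArg (conjugate (ζ ^ (k : ℕ))) hmod
    simp only [map_add, map_sub, map_mul, map_pow, map_one, map_ofNat, hVconj] at h1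
    simp only [hr, hc, Finset.sum_range_succ, Finset.sum_range_zero]
    norm_num
    linear_combination h1
  obtain ⟨h0, h1, h2, h3, h4, h5, h6⟩ := prod_and_power_sums_of_roots r hinj c hroot
    (fun i ↦ φ (7 * expand 7 (by norm_num) (huffU (w ^ i)))) (fun i ↦ by
      rw [hφ, ← sum_conjugate hζ]
      simp [hr])
  -- The constant term of the polynomial equates V² with the norm of w, giving V = ±t(q^7); the
  -- coefficient of q^7 decides the sign, because T has constant term -1.
  have hVt : V = -t7 := by
    have h7 : V ^ 2 = t7 ^ 2 := by
      apply hφinj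
      rw [ht7, ht, hφ, ← prod_conjugate_eulerQuotient hζ, ← hφ, ← hw, map_pow]
      exact h0.symm
    rcases sq_eq_sq_iff_eq_or_eq_neg.mp h7 with h8 | h8
    · exfalso
      rw [h8, ht7, ht, expand_hauptmodul] at hVT
      have h9 := congrArg (coeff (0 + 7)) hVT
      rw [mul_assoc, mul_assoc, coeff_X_pow_mul, coeff_X_pow_mul] at h9
      simp [constantCoeff_pentagonalSeries, constantCoeff_eulerInv, hT0] at h9
    · exact h8
  have hφt : φ V = -φ (expand 7 (by norm_num) t) := by rw [hVt, map_neg, ht7]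
  simp only [hc, hφt, map_mul, map_ofNat] at h1 h2 h3 h4 h5 h6
  norm_num at h1 h2 h3 h4 h5 h6
  refine ⟨?_, ?_, ?_, ?_, ?_, ?_, ?_⟩
  · rw [hmod, hVt]; ring
  · apply eq_of_map_seven_mul_expand
    simp only [← hφ, map_add, map_mul, map_pow, map_ofNat]
    linear_combination h1
  · apply eq_of_map_seven_mul_expand
    simp only [← hφ, map_add, map_mul, map_pow, map_ofNat]
    linear_combination h2
  · apply eq_of_map_seven_mul_expand
    simp only [← hφ, map_add, map_mul, map_pow, map_ofNat]
    linear_combination h3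
  · apply eq_of_map_seven_mul_expand
    simp only [← hφ, map_add, map_mul, map_pow, map_ofNat]
    linear_combination h4
  · apply eq_of_map_seven_mul_expand
    simp only [← hφ, map_add, map_mul, map_pow, map_ofNat]
    linear_combination h5
  · apply eq_of_map_seven_mul_expand
    simp only [← hφ, map_add, map_mul, map_pow, map_ofNat]
    linear_combination h6

/-- U is linear over series in q^7. This lets factors g(q^7) be pulled out everywhere below. -/
theorem huffU_mul_expand (f g : ℤ⟦X⟧) :
    huffU (f * expand 7 (by norm_num) g) = huffU f * g := by
  ext n
  rw [coeff_huffU, coeff_mul, coeff_mul]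
  symm
  refine Finset.sum_of_injOn (fun a ↦ (7 * a.1, 7 * a.2)) ?_ ?_ ?_ ?_
  · intro a _ b _ h
    simp only [Prod.mk.injEq] at h
    ext <;> omega
  · intro a ha
    replace ha := Finset.HasAntidiagonal.mem_antidiagonal.mp ha
    refine Finset.HasAntidiagonal.mem_antidiagonal.mpr ?_
    dsimp only
    omega
  · intro a ha hne
    replace ha := Finset.HasAntidiagonal.mem_antidiagonal.mp ha
    rw [coeff_expand_of_not_dvd, mul_zero]
    rintro ⟨b, hb⟩
    refine hne ⟨(n - b, b), Finset.HasAntidiagonal.mem_antidiagonal.mpr ?_, ?_⟩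
    · dsimp only; omega
    · ext <;> dsimp only <;> omega
  · intro a _
    rw [coeff_huffU, coeff_expand_mul]

theorem eulerQuotient_pow_four :
    eulerQuotient ^ 4 = hauptmodul * expand 7 (by norm_num) hauptmodul := by
  rw [expand_hauptmodul, eulerQuotient, hauptmodul]
  have h : (expand 7 (by norm_num) (pentagonalSeries ℤ)) ^ 4 *
      (expand 7 (by norm_num) eulerInv) ^ 4 = 1 := by
    rw [← mul_pow, expand_pentagonalSeries_mul_eulerInv, one_pow]
  linear_combination (-X ^ 8 * expand 49 (by norm_num) (pentagonalSeries ℤ) ^ 4 * eulerInv ^ 4) * h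

theorem hauptmodul_ne_zero : hauptmodul ≠ 0 := by
  have h : constantCoeff (expand 7 (by norm_num) (pentagonalSeries ℤ) ^ 4 * eulerInv ^ 4) = 1 := by
    simp [constantCoeff_pentagonalSeries, constantCoeff_eulerInv]
  rw [hauptmodul, mul_assoc]
  refine mul_ne_zero X_ne_zero fun h0 ↦ ?_
  simp [h0] at h

/-! ### 7-adic bounds for U(w^i) -/

section Bound

/-- `f` is a polynomial in the Hauptmodul whose coefficients satisfy the `7`-adic bounds valid for
the image of the `i`-th power of `eulerQuotient`. -/
def HasHuffBound (i : ℕ) (f : ℤ⟦X⟧) : Prop :=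
  ∃ p : Polynomial ℤ, f = Polynomial.aeval hauptmodul p ∧
    ∀ j, (7 * j < 2 * i → p.coeff j = 0) ∧ ∀ a, 4 * a + 2 * i + 1 ≤ 7 * j → 7 ^ a ∣ p.coeff j

theorem HasHuffBound.add {i : ℕ} {f g : ℤ⟦X⟧} (hf : HasHuffBound i f) (hg : HasHuffBound i g) :
    HasHuffBound i (f + g) := by
  obtain ⟨p, rfl, hp⟩ := hf
  obtain ⟨q, rfl, hq⟩ := hg
  refine ⟨p + q, by rw [map_add], fun j ↦ ⟨fun h ↦ ?_, fun a h ↦ ?_⟩⟩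
  · rw [Polynomial.coeff_add, (hp j).1 h, (hq j).1 h, add_zero]
  · rw [Polynomial.coeff_add]
    exact dvd_add ((hp j).2 a h) ((hq j).2 a h)

/-- The bound asks the coefficient of t^j for valuation at least ⌊(7j - 2i - 1)/4⌋ and for vanishing
when j < 2i/7. Multiplying by c t^d while raising i by s moves these thresholds by at most what `hd`
and `hv` allow. -/
theorem HasHuffBound.smul_pow_mul {i : ℕ} {f : ℤ⟦X⟧} (hf : HasHuffBound i f) {k : ℕ} (c : ℤ) (d s v : ℕ)
    (hk : k = i + s) (hc : 7 ^ v ∣ c) (hd : 2 * s ≤ 7 * d) (hv : 7 * d ≤ 4 * v + 2 * s) :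
    HasHuffBound k ((c : ℤ⟦X⟧) * hauptmodul ^ d * f) := by
  subst hk
  obtain ⟨p, rfl, hp⟩ := hf
  refine ⟨Polynomial.C c * (p * Polynomial.X ^ d), ?_, fun j ↦ ?_⟩
  · rw [map_mul, map_mul, map_pow, Polynomial.aeval_X, Polynomial.aeval_C, eq_intCast]
    ring
  rw [Polynomial.coeff_C_mul, Polynomial.coeff_mul_X_pow']
  split_ifs with h
  · refine ⟨fun h1 ↦ ?_, fun a h1 ↦ ?_⟩
    · rw [(hp (j - d)).1 (by omega), mul_zero]
    · rcases le_total a v with hav | hav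
      · exact (pow_dvd_pow 7 hav).trans (hc.trans (dvd_mul_right _ _))
      · rw [← Nat.add_sub_cancel' hav, pow_add]
        exact mul_dvd_mul hc ((hp (j - d)).2 (a - v) (by omega))
  · simp

/-- Because of the floor, a single monomial has 4 units more room than a multiplier. This pays for
the division by 7 in the terms m·c_(7-m)/7 of Newton's identities. -/
theorem hasHuffBound_smul_pow (i : ℕ) (c : ℤ) (d v : ℕ) (hc : 7 ^ v ∣ c) (hd : 2 * i ≤ 7 * d)
    (hv : 7 * d ≤ 4 * v + 2 * i + 4) : HasHuffBound i ((c : ℤ⟦X⟧) * hauptmodul ^ d) := by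
  refine ⟨Polynomial.C c * Polynomial.X ^ d, ?_, fun j ↦ ?_⟩
  · rw [map_mul, map_pow, Polynomial.aeval_X, Polynomial.aeval_C, eq_intCast]
  rw [Polynomial.coeff_C_mul_X_pow]
  split_ifs with h
  · refine ⟨fun h1 ↦ by omega, fun a h1 ↦ (pow_dvd_pow 7 (by omega)).trans hc⟩
  · simp

theorem huffU_intCast_mul_expand_pow_mul (c : ℤ) (d : ℕ) (f : ℤ⟦X⟧) :
    huffU (c * expand 7 (by norm_num) hauptmodul ^ d * f) = c * hauptmodul ^ d * huffU f := by
  have h := huffU_mul_expand f (c * hauptmodul ^ d)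
  rw [map_mul (expand 7 (by norm_num)), map_pow, map_intCast] at h
  rw [mul_comm, h, mul_comm]

theorem huffU_eulerQuotient_pow_add_seven (j : ℕ) : huffU (eulerQuotient ^ (j + 7)) =
      (1 : ℤ) * hauptmodul ^ 2 * huffU (eulerQuotient ^ j) +
      (7 : ℤ) * hauptmodul ^ 2 * huffU (eulerQuotient ^ (j + 1)) +
      (21 : ℤ) * hauptmodul ^ 2 * huffU (eulerQuotient ^ (j + 2)) +
      (49 : ℤ) * hauptmodul ^ 2 * huffU (eulerQuotient ^ (j + 3)) +
      ((147 : ℤ) * hauptmodul ^ 2 * huffU (eulerQuotient ^ (j + 4)) +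
      (7 : ℤ) * hauptmodul ^ 1 * huffU (eulerQuotient ^ (j + 4))) +
      ((343 : ℤ) * hauptmodul ^ 2 * huffU (eulerQuotient ^ (j + 5)) +
      (35 : ℤ) * hauptmodul ^ 1 * huffU (eulerQuotient ^ (j + 5))) +
      ((343 : ℤ) * hauptmodul ^ 2 * huffU (eulerQuotient ^ (j + 6)) +
      (49 : ℤ) * hauptmodul ^ 1 * huffU (eulerQuotient ^ (j + 6))) := by
  have h : eulerQuotient ^ (j + 7) =
      (1 : ℤ) * expand 7 (by norm_num) hauptmodul ^ 2 * eulerQuotient ^ j +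
      (7 : ℤ) * expand 7 (by norm_num) hauptmodul ^ 2 * eulerQuotient ^ (j + 1) +
      (21 : ℤ) * expand 7 (by norm_num) hauptmodul ^ 2 * eulerQuotient ^ (j + 2) +
      (49 : ℤ) * expand 7 (by norm_num) hauptmodul ^ 2 * eulerQuotient ^ (j + 3) +
      ((147 : ℤ) * expand 7 (by norm_num) hauptmodul ^ 2 * eulerQuotient ^ (j + 4) +
      (7 : ℤ) * expand 7 (by norm_num) hauptmodul ^ 1 * eulerQuotient ^ (j + 4)) +
      ((343 : ℤ) * expand 7 (by norm_num) hauptmodul ^ 2 * eulerQuotient ^ (j + 5) +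
      (35 : ℤ) * expand 7 (by norm_num) hauptmodul ^ 1 * eulerQuotient ^ (j + 5)) +
      ((343 : ℤ) * expand 7 (by norm_num) hauptmodul ^ 2 * eulerQuotient ^ (j + 6) +
      (49 : ℤ) * expand 7 (by norm_num) hauptmodul ^ 1 * eulerQuotient ^ (j + 6)) := by
    rw [pow_add, (eulerQuotient_pow_seven_and_newton rfl rfl rfl).1]
    generalize expand 7 (by norm_num) hauptmodul = t
    push_cast
    ring
  rw [h]
  simp only [map_add, huffU_intCast_mul_expand_pow_mul]

theorem hasHuffBound_huffU_eulerQuotient_pow (i : ℕ) :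
    HasHuffBound i (huffU (eulerQuotient ^ i)) := by
  obtain ⟨-, e1, e2, e3, e4, e5, e6⟩ := eulerQuotient_pow_seven_and_newton rfl rfl rfl
  have h0 : HasHuffBound 0 (huffU (eulerQuotient ^ 0)) := by
    have h : huffU (eulerQuotient ^ 0) = (1 : ℤ) * hauptmodul ^ 0 := by
      ext n
      rw [pow_zero, coeff_huffU, pow_zero, mul_one, Int.cast_one, coeff_one, coeff_one]
      simp
    rw [h]
    exact hasHuffBound_smul_pow 0 1 0 0 (by norm_num) (by norm_num) (by norm_num)
  have h1 : HasHuffBound 1 (huffU (eulerQuotient ^ 1)) := by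
    have h := (hasHuffBound_smul_pow 1 49 2 2 (by norm_num) (by norm_num) (by norm_num)).add
      (hasHuffBound_smul_pow 1 7 1 1 (by norm_num) (by norm_num) (by norm_num))
    rw [pow_one, e1]
    convert h using 1
    push_cast; ring
  -- Each `c` with index 7 - s treats the coefficient of w^(7-s) in the modular equation; the
  -- numerals are coefficient, power of t, shift s and 7-adic valuation used.
  have c6 {i k : ℕ} {f : ℤ⟦X⟧} (hf : HasHuffBound i f) (hk : k = i + 1) :=
    (hf.smul_pow_mul 343 2 1 3 hk (by norm_num)
    (by norm_num) (by norm_num)).add (hf.smul_pow_mul 49 1 1 2 hk (by norm_num) (by norm_num)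
    (by norm_num))
  have c5 {i k : ℕ} {f : ℤ⟦X⟧} (hf : HasHuffBound i f) (hk : k = i + 2) :=
    (hf.smul_pow_mul 343 2 2 3 hk (by norm_num)
    (by norm_num) (by norm_num)).add (hf.smul_pow_mul 35 1 2 1 hk (by norm_num) (by norm_num)
    (by norm_num))
  have c4 {i k : ℕ} {f : ℤ⟦X⟧} (hf : HasHuffBound i f) (hk : k = i + 3) :=
    (hf.smul_pow_mul 147 2 3 2 hk (by norm_num)
    (by norm_num) (by norm_num)).add (hf.smul_pow_mul 7 1 3 1 hk (by norm_num) (by norm_num)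
    (by norm_num))
  have c3 {i k : ℕ} {f : ℤ⟦X⟧} (hf : HasHuffBound i f) (hk : k = i + 4) :=
    hf.smul_pow_mul 49 2 4 2 hk (by norm_num)
    (by norm_num) (by norm_num)
  have c2 {i k : ℕ} {f : ℤ⟦X⟧} (hf : HasHuffBound i f) (hk : k = i + 5) :=
    hf.smul_pow_mul 21 2 5 1 hk (by norm_num)
    (by norm_num) (by norm_num)
  have c1 {i k : ℕ} {f : ℤ⟦X⟧} (hf : HasHuffBound i f) (hk : k = i + 6) :=
    hf.smul_pow_mul 7 2 6 1 hk (by norm_num)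
    (by norm_num) (by norm_num)
  have c0 {i k : ℕ} {f : ℤ⟦X⟧} (hf : HasHuffBound i f) (hk : k = i + 7) :=
    hf.smul_pow_mul 1 2 7 0 hk (by norm_num)
    (by norm_num) (by norm_num)
  rw [← pow_one eulerQuotient] at e2 e3 e4 e5 e6
  simp only [← pow_mul, one_mul] at e2 e3 e4 e5 e6
  have h2 : HasHuffBound 2 (huffU (eulerQuotient ^ 2)) := by
    have h := (c6 h1 rfl).add
      ((hasHuffBound_smul_pow 2 98 2 2 (by norm_num) (by norm_num) (by norm_num)).add
        (hasHuffBound_smul_pow 2 10 1 0 (by norm_num) (by norm_num) (by norm_num)))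
    rw [e2]
    convert h using 1
    push_cast; ring
  have h3 : HasHuffBound 3 (huffU (eulerQuotient ^ 3)) := by
    have h := ((c6 h2 rfl).add (c5 h1 rfl)).add
      ((hasHuffBound_smul_pow 3 63 2 1 (by norm_num) (by norm_num) (by norm_num)).add
        (hasHuffBound_smul_pow 3 3 1 0 (by norm_num) (by norm_num) (by norm_num)))
    rw [e3]
    convert h using 1
    push_cast; ring
  have h4 : HasHuffBound 4 (huffU (eulerQuotient ^ 4)) := by
    have h := (((c6 h3 rfl).add (c5 h2 rfl)).add (c4 h1 rfl)).add
      (hasHuffBound_smul_pow 4 28 2 1 (by norm_num) (by norm_num) (by norm_num))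
    rw [e4]
    convert h using 1
    push_cast; ring
  have h5 : HasHuffBound 5 (huffU (eulerQuotient ^ 5)) := by
    have h := ((((c6 h4 rfl).add (c5 h3 rfl)).add (c4 h2 rfl)).add (c3 h1 rfl)).add
      (hasHuffBound_smul_pow 5 15 2 0 (by norm_num) (by norm_num) (by norm_num))
    rw [e5]
    convert h using 1
    push_cast; ring
  have h6 : HasHuffBound 6 (huffU (eulerQuotient ^ 6)) := by
    have h := (((((c6 h5 rfl).add (c5 h4 rfl)).add (c4 h3 rfl)).add (c3 h2 rfl)).add (c2 h1 rfl)).add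
      (hasHuffBound_smul_pow 6 6 2 0 (by norm_num) (by norm_num) (by norm_num))
    rw [e6]
    convert h using 1
    push_cast; ring
  induction i using Nat.strong_induction_on with
  | _ i ih =>
    rcases lt_or_ge i 7 with hi | hi
    · clear ih
      interval_cases i
      exacts [h0, h1, h2, h3, h4, h5, h6]
    · obtain ⟨j, rfl⟩ := Nat.exists_eq_add_of_le' hi
      rw [huffU_eulerQuotient_pow_add_seven]
      exact ((((((c0 (ih j (by omega)) (by omega)).add (c1 (ih (j + 1) (by omega)) (by omega))).add
        (c2 (ih (j + 2) (by omega)) (by omega))).add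
        (c3 (ih (j + 3) (by omega)) (by omega))).add
        (c4 (ih (j + 4) (by omega)) (by omega))).add
        (c5 (ih (j + 5) (by omega)) (by omega))).add
        (c6 (ih (j + 6) (by omega)) (by omega))

end Bound

/-! ### Stability of the lattice ℤ[7t] -/

section Lattice

theorem exists_aeval_seven_mul {p : Polynomial ℤ} {K e : ℕ}
    (h : ∀ i, (7 : ℤ) ^ (e + i) ∣ 7 ^ K * p.coeff i) (t : ℤ⟦X⟧) :
    ∃ q : Polynomial ℤ, 7 ^ K * Polynomial.aeval t p = 7 ^ e * Polynomial.aeval (7 * t) q := by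
  choose b hb using h
  refine ⟨∑ i ∈ Finset.range (p.natDegree + 1), Polynomial.C (b i) * Polynomial.X ^ i, ?_⟩
  rw [Polynomial.aeval_eq_sum_range, map_sum, Finset.mul_sum, Finset.mul_sum]
  refine Finset.sum_congr rfl fun i _ ↦ ?_
  have h1 := congrArg (Int.cast (R := ℤ⟦X⟧)) (hb i)
  push_cast at h1
  rw [map_mul, map_pow, Polynomial.aeval_X, Polynomial.aeval_C, eq_intCast,
    Algebra.smul_def, eq_intCast, mul_pow]
  linear_combination t ^ i * h1

/-- Translates the bounds: `h1` makes the polynomial for U(w^N) divisible by t^(J+s), and `h2` gives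
the next coefficient enough powers of 7. Later coefficients follow, as the bound grows by 7/4 per
step and only 1 is needed. -/
theorem exists_lattice_of_pow_mul_eq {N J K e s : ℕ} {g : ℤ⟦X⟧} (h1 : 7 * (J + s) < 2 * N + 7)
    (h2 : 4 * e + 2 * N + 1 ≤ 4 * K + 7 * (J + s))
    (hg : hauptmodul ^ J * g = huffU (eulerQuotient ^ N)) :
    ∃ q : Polynomial ℤ,
      7 ^ K * g = 7 ^ e * hauptmodul ^ s * Polynomial.aeval (7 * hauptmodul) q := by
  obtain ⟨p, hp, hb⟩ := hasHuffBound_huffU_eulerQuotient_pow N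
  obtain ⟨p', rfl⟩ : Polynomial.X ^ (J + s) ∣ p :=
    Polynomial.X_pow_dvd_iff.mpr fun d hd ↦ (hb d).1 (by omega)
  rw [hp, map_mul, map_pow, Polynomial.aeval_X, pow_add, mul_assoc] at hg
  have hg' := mul_left_cancel₀ (pow_ne_zero J hauptmodul_ne_zero) hg
  obtain ⟨q, hq⟩ := exists_aeval_seven_mul (p := p') (K := K) (e := e) (fun i ↦ by
    rcases le_total (e + i) K with h | h
    · exact (pow_dvd_pow 7 h).trans (dvd_mul_right _ _)
    · have h3 := (hb (i + (J + s))).2 (e + i - K) (by omega)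
      rw [mul_comm (Polynomial.X ^ _), Polynomial.coeff_mul_X_pow] at h3
      rw [← Nat.add_sub_cancel' h, pow_add]
      exact mul_dvd_mul_left _ h3) hauptmodul
  exact ⟨q, by rw [hg']; linear_combination hauptmodul ^ s * hq⟩

/-- By additivity it is enough to test the generators (7t)^j of the lattice. -/
theorem AddMonoidHom.exists_lattice (Φ : ℤ⟦X⟧ →+ ℤ⟦X⟧) (y : ℤ⟦X⟧)
    (h : ∀ j : ℕ, ∃ q : Polynomial ℤ,
      7 ^ j * Φ (hauptmodul ^ j) = y * Polynomial.aeval (7 * hauptmodul) q) (p : Polynomial ℤ) :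
    ∃ q : Polynomial ℤ, Φ (Polynomial.aeval (7 * hauptmodul) p) =
      y * Polynomial.aeval (7 * hauptmodul) q := by
  induction p using Polynomial.induction_on' with
  | add p q hp hq =>
    obtain ⟨p', hp'⟩ := hp
    obtain ⟨q', hq'⟩ := hq
    exact ⟨p' + q', by rw [map_add, map_add, hp', hq', map_add, mul_add]⟩
  | monomial n a =>
    obtain ⟨q, hq⟩ := h n
    refine ⟨Polynomial.C a * q, ?_⟩
    have h1 : Polynomial.aeval (7 * hauptmodul) (Polynomial.monomial n a) =
        (a * 7 ^ n : ℤ) • hauptmodul ^ n := by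
      rw [Polynomial.aeval_monomial, eq_intCast, zsmul_eq_mul, mul_pow]
      push_cast
      ring
    rw [h1, map_zsmul, zsmul_eq_mul, map_mul, Polynomial.aeval_C, eq_intCast]
    push_cast
    linear_combination (a : ℤ⟦X⟧) * hq

/-- The factor t^j enters U as t(q^7)^j and combines with t^j to w^(4j). -/
theorem hauptmodul_pow_mul_huffU (r j : ℕ) :
    hauptmodul ^ j * huffU (eulerQuotient ^ r * hauptmodul ^ j) =
      huffU (eulerQuotient ^ (4 * j + r)) := by
  rw [mul_comm, ← huffU_mul_expand, map_pow, mul_assoc, ← mul_pow, ← eulerQuotient_pow_four,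
    ← pow_mul, ← pow_add, add_comm]

theorem exists_huffU_hauptmodul_mul (p : Polynomial ℤ) :
    ∃ q : Polynomial ℤ, huffU (hauptmodul * Polynomial.aeval (7 * hauptmodul) p) =
      7 * hauptmodul * Polynomial.aeval (7 * hauptmodul) q := by
  refine (huffU.comp (AddMonoidHom.mulLeft hauptmodul)).exists_lattice _ (fun j ↦ ?_) p
  obtain ⟨q, hq⟩ := exists_lattice_of_pow_mul_eq (N := 4 * j + 4) (J := j + 1) (K := j) (e := 1)
    (s := 1) (by omega) (by omega) (hauptmodul_pow_mul_huffU 0 (j + 1))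
  refine ⟨q, ?_⟩
  rw [pow_zero, one_mul, pow_one, pow_one] at hq
  rw [← hq, pow_succ', AddMonoidHom.comp_apply, AddMonoidHom.coe_mulLeft]

theorem exists_huffU_eulerQuotient_mul_hauptmodul_mul (p : Polynomial ℤ) :
    ∃ q : Polynomial ℤ,
      huffU (eulerQuotient * (hauptmodul * Polynomial.aeval (7 * hauptmodul) p)) =
        hauptmodul * Polynomial.aeval (7 * hauptmodul) q := by
  simp only [← mul_assoc eulerQuotient]
  refine (huffU.comp (AddMonoidHom.mulLeft (eulerQuotient * hauptmodul))).exists_lattice _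
    (fun j ↦ ?_) p
  obtain ⟨q, hq⟩ := exists_lattice_of_pow_mul_eq (N := 4 * (j + 1) + 1) (J := j + 1) (K := j)
    (e := 0) (s := 1) (by omega) (by omega) (hauptmodul_pow_mul_huffU 1 (j + 1))
  refine ⟨q, ?_⟩
  rw [pow_zero, one_mul, pow_one, pow_one] at hq
  rw [← hq, pow_succ', AddMonoidHom.comp_apply, AddMonoidHom.coe_mulLeft, mul_assoc]

theorem exists_huffU_eulerQuotient_pow_three_mul (p : Polynomial ℤ) :
    ∃ q : Polynomial ℤ, huffU (eulerQuotient ^ 3 * Polynomial.aeval (7 * hauptmodul) p) =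
      hauptmodul * Polynomial.aeval (7 * hauptmodul) q := by
  refine (huffU.comp (AddMonoidHom.mulLeft (eulerQuotient ^ 3))).exists_lattice _ (fun j ↦ ?_) p
  obtain ⟨q, hq⟩ := exists_lattice_of_pow_mul_eq (N := 4 * j + 3) (J := j) (K := j)
    (e := 0) (s := 1) (by omega) (by omega) (hauptmodul_pow_mul_huffU 3 j)
  refine ⟨q, ?_⟩
  rw [pow_zero, one_mul, pow_one] at hq
  rw [← hq, AddMonoidHom.comp_apply, AddMonoidHom.coe_mulLeft]

theorem exists_huffU_eulerQuotient_mul (p : Polynomial ℤ) :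
    ∃ q : Polynomial ℤ, huffU (eulerQuotient * Polynomial.aeval (7 * hauptmodul) p) =
      7 * hauptmodul * Polynomial.aeval (7 * hauptmodul) q := by
  refine (huffU.comp (AddMonoidHom.mulLeft eulerQuotient)).exists_lattice _ (fun j ↦ ?_) p
  obtain ⟨q, hq⟩ := exists_lattice_of_pow_mul_eq (N := 4 * j + 1) (J := j) (K := j)
    (e := 1) (s := 1) (by omega) (by omega) (hauptmodul_pow_mul_huffU 1 j)
  refine ⟨q, ?_⟩
  rw [pow_one, pow_one, pow_one] at hq
  rw [← hq, AddMonoidHom.comp_apply, AddMonoidHom.coe_mulLeft]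

end Lattice

/-! ### Generating functions and iterates of U -/

/-- The generating function of `ℓ`-regular partitions. -/
noncomputable def regularSeries (ℓ : ℕ) : ℤ⟦X⟧ :=
  mk fun n ↦ (regularPartitionCount ℓ n : ℤ)

theorem regularSeries_mul_pentagonalSeries {ℓ : ℕ} (hℓ : ℓ ≠ 0) :
    regularSeries ℓ * pentagonalSeries ℤ = expand ℓ hℓ (pentagonalSeries ℤ) := by
  have h1 : HasProd _ (regularSeries ℓ) :=
    Nat.Partition.hasProd_powerSeriesMk_card_restricted ℤ (fun i ↦ ¬ ℓ ∣ i)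
  have h2 := h1.mul (WithPiTopology.hasProd_one_sub_X_pow ℤ)
  have h3 := hasProd_ite_dvd hℓ (f := fun n ↦ (1 - X ^ n : ℤ⟦X⟧))
    (hasProd_expand_pentagonalSeries hℓ)
  refine h2.unique ?_
  convert h3 using 2 with n
  by_cases h : ℓ ∣ n + 1
  · rw [if_neg (not_not.mpr h), if_pos h, one_mul]
  · rw [if_pos h, if_neg h]
    simp only [pow_mul]
    exact WithPiTopology.tsum_pow_mul_one_sub_of_constantCoeff_eq_zero (by simp)

theorem regularSeries_eq {ℓ : ℕ} (hℓ : ℓ ≠ 0) :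
    regularSeries ℓ = expand ℓ hℓ (pentagonalSeries ℤ) * eulerInv := by
  linear_combination eulerInv * regularSeries_mul_pentagonalSeries hℓ -
    regularSeries ℓ * pentagonalSeries_mul_eulerInv

theorem coeff_huffU_iterate (m n : ℕ) (f : ℤ⟦X⟧) :
    coeff n (huffU^[m] f) = coeff (7 ^ m * n) f := by
  induction m generalizing f with
  | zero => simp
  | succ m ih => rw [Function.iterate_succ_apply, ih, coeff_huffU, pow_succ', mul_assoc]

theorem huffU_iterate_mul_expand (m : ℕ) (f g : ℤ⟦X⟧) :
    huffU^[m] (f * expand (7 ^ m) (by positivity) g) = huffU^[m] f * g := by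
  induction m generalizing f with
  | zero => simp
  | succ m ih =>
    have h : expand (7 ^ (m + 1)) (by positivity) g =
        expand 7 (by norm_num) (expand (7 ^ m) (by positivity) g) := by
      rw [← expand_mul]
      simp only [pow_succ']
    rw [Function.iterate_succ_apply, Function.iterate_succ_apply, h, huffU_mul_expand, ih]

theorem huffU_seven_pow_mul (e : ℕ) (f : ℤ⟦X⟧) : huffU (7 ^ e * f) = 7 ^ e * huffU f := by
  have h (g : ℤ⟦X⟧) : 7 ^ e * g = (7 ^ e : ℕ) • g := by rw [nsmul_eq_mul]; push_cast; rfl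
  rw [h, h, map_nsmul]

theorem dvd_coeff_seven_pow_mul (e : ℕ) (f : ℤ⟦X⟧) (n : ℕ) : (7 : ℤ) ^ e ∣ coeff n (7 ^ e * f) := by
  rw [show (7 : ℤ⟦X⟧) ^ e = C (7 ^ e) by simp, coeff_C_mul]
  exact dvd_mul_right _ _

/-! ### Levels 7^(2k) -/

section EvenLevel

/-- The series `q ^ ((49 ^ k - 1) / 24) * E(q ^ 49 ^ k) / E(q)`. -/
noncomputable def iteratedQuotient : ℕ → ℤ⟦X⟧
  | 0 => 1
  | k + 1 => eulerQuotient * expand 49 (by norm_num) (iteratedQuotient k)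

theorem exists_iteratedQuotient_eq (k : ℕ) : ∃ N, 24 * N + 1 = 7 ^ (2 * k) ∧
    iteratedQuotient k =
      X ^ N * (expand (7 ^ (2 * k)) (by positivity) (pentagonalSeries ℤ) * eulerInv) := by
  induction k with
  | zero => exact ⟨0, by norm_num, by simp [iteratedQuotient, pentagonalSeries_mul_eulerInv]⟩
  | succ k ih =>
    obtain ⟨N, hN, h⟩ := ih
    refine ⟨49 * N + 2, ?_, ?_⟩
    · rw [show 7 ^ (2 * (k + 1)) = 49 * 7 ^ (2 * k) by ring, ← hN]
      ring
    · have h1 : expand (7 ^ (2 * (k + 1))) (by positivity) (pentagonalSeries ℤ) =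
          expand 49 (by norm_num) (expand (7 ^ (2 * k)) (by positivity) (pentagonalSeries ℤ)) := by
        rw [← expand_mul]
        simp only [mul_add, pow_add, mul_one, mul_comm 49]
        norm_num
      have h2 := expand_pentagonalSeries_mul_eulerInv (p := 49) (by norm_num)
      rw [h1, iteratedQuotient, h, eulerQuotient]
      simp only [map_mul, map_pow, expand_X, ← pow_mul]
      generalize expand 49 (by norm_num) (expand (7 ^ (2 * k)) _ (pentagonalSeries ℤ)) = Y
      linear_combination (X ^ 2 * eulerInv * X ^ (49 * N) * Y) * h2

/-- The inner factor is a series in q^49, so it passes through two applications of U; peeling off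
one w at a time alternates multiplication by w with U². -/
theorem huffU_iterate_mul_iteratedQuotient (k : ℕ) (f : ℤ⟦X⟧) :
    huffU^[2 * k + 1] (f * iteratedQuotient (k + 1)) =
      huffU (eulerQuotient * (fun g ↦ huffU (huffU (eulerQuotient * g)))^[k] f) := by
  induction k generalizing f with
  | zero => simp [iteratedQuotient, mul_comm]
  | succ k ih =>
    rw [show 2 * (k + 1) + 1 = 2 * k + 1 + 1 + 1 by ring, Function.iterate_succ_apply,
      Function.iterate_succ_apply, iteratedQuotient, ← mul_assoc, mul_comm f,
      ← expand_seven_expand_seven, huffU_mul_expand, huffU_mul_expand, ih,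
      Function.iterate_succ_apply]

theorem exists_huffU_iterate_iteratedQuotient (k : ℕ) : ∃ q : Polynomial ℤ,
    huffU^[2 * k + 1] (iteratedQuotient (k + 1)) =
      7 ^ (k + 1) * (hauptmodul * Polynomial.aeval (7 * hauptmodul) q) := by
  rw [← one_mul (iteratedQuotient (k + 1)), huffU_iterate_mul_iteratedQuotient]
  induction k with
  | zero =>
    obtain ⟨q, hq⟩ := exists_huffU_eulerQuotient_mul 1
    refine ⟨q, ?_⟩
    rw [map_one] at hq
    rw [Function.iterate_zero_apply, hq]
    ring
  | succ k ih =>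
    obtain ⟨q, hq⟩ := ih
    -- One round applies U, which gains the factor 7, and then U after multiplication by w, with two
    -- more U's in total; the composite U(w · U(·)) keeps the form tL with one extra 7.
    obtain ⟨q1, hq1⟩ := exists_huffU_hauptmodul_mul q
    obtain ⟨q2, hq2⟩ := exists_huffU_eulerQuotient_mul_hauptmodul_mul q1
    refine ⟨q2, ?_⟩
    rw [Function.iterate_succ_apply', hq, huffU_seven_pow_mul, hq1, mul_assoc, ← mul_assoc (7 ^ _),
      ← pow_succ, mul_left_comm, huffU_seven_pow_mul, hq2]

theorem exists_huffU_iterate_lattice (e β : ℕ) (p : Polynomial ℤ) : ∃ q : Polynomial ℤ,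
    huffU^[β] (7 ^ e * (hauptmodul * Polynomial.aeval (7 * hauptmodul) p)) =
      7 ^ (e + β) * (hauptmodul * Polynomial.aeval (7 * hauptmodul) q) := by
  induction β with
  | zero => exact ⟨p, rfl⟩
  | succ β ih =>
    obtain ⟨q, hq⟩ := ih
    obtain ⟨q1, hq1⟩ := exists_huffU_hauptmodul_mul q
    refine ⟨q1, ?_⟩
    rw [Function.iterate_succ_apply', hq, huffU_seven_pow_mul, hq1]
    ring

theorem seven_pow_dvd_regularPartitionCount_even (k β n N : ℕ) (hN : 24 * N + 1 = 7 ^ (2 * (k + 1))) :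
    7 ^ (k + 1 + β) ∣
      regularPartitionCount (7 ^ (2 * (k + 1))) (7 ^ (2 * k + 1 + β) * (n + 1) - N) := by
  obtain ⟨N', hN', h⟩ := exists_iteratedQuotient_eq (k + 1)
  obtain rfl : N' = N := by omega
  rw [← regularSeries_eq] at h
  obtain ⟨q, hq⟩ := exists_huffU_iterate_iteratedQuotient k
  obtain ⟨q1, hq1⟩ := exists_huffU_iterate_lattice (k + 1) β q
  rw [← hq, ← Function.iterate_add_apply, h] at hq1
  have h1 := dvd_coeff_seven_pow_mul (k + 1 + β)
    (hauptmodul * Polynomial.aeval (7 * hauptmodul) q1) (n + 1)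
  have hle : N' ≤ 7 ^ (2 * k + 1 + β) * (n + 1) := by
    have h2 : 7 ^ (2 * (k + 1)) = 7 * 7 ^ (2 * k + 1) := by ring
    have h3 : 7 ^ (2 * k + 1) ≤ 7 ^ (2 * k + 1 + β) := Nat.pow_le_pow_right (by norm_num) (by omega)
    have h4 : 7 ^ (2 * k + 1 + β) ≤ 7 ^ (2 * k + 1 + β) * (n + 1) := Nat.le_mul_of_pos_right _ (by omega)
    omega
  rw [← hq1, coeff_huffU_iterate, add_comm β, coeff_X_pow_mul', if_pos hle, regularSeries,
    coeff_mk] at h1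
  exact_mod_cast h1

end EvenLevel

/-! ### Levels 7^(2k-1) -/

section OddLevel

/-- Two applications of `huffU` with shifts, on series multiplied by `q`: it extracts the
exponents `49 n + 37`. -/
noncomputable def shiftedHuffU (f : ℤ⟦X⟧) : ℤ⟦X⟧ :=
  huffU (X * huffU (X ^ 5 * f))

theorem coeff_shiftedHuffU (f : ℤ⟦X⟧) (n : ℕ) :
    coeff (n + 1) (shiftedHuffU f) = coeff (49 * n + 37) f := by
  rw [shiftedHuffU, coeff_huffU, show 7 * (n + 1) = 7 * n + 6 + 1 by ring, coeff_succ_X_mul,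
    coeff_huffU, show 7 * (7 * n + 6) = 49 * n + 37 + 5 by ring, coeff_X_pow_mul]

theorem exists_coeff_shiftedHuffU_iterate (β n : ℕ) : ∃ c, 4 * c + 3 = 49 ^ β * (4 * n + 3) ∧
    ∀ f, coeff (n + 1) (shiftedHuffU^[β] f) = coeff (c + 1) f := by
  induction β generalizing n with
  | zero => exact ⟨n, by simp, fun f ↦ rfl⟩
  | succ β ih =>
    -- The invariant is explained by 4(49n + 36) + 3 = 49(4n + 3).
    obtain ⟨c, hc, h⟩ := ih (49 * n + 36)
    refine ⟨c, by rw [hc]; ring, fun f ↦ ?_⟩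
    rw [Function.iterate_succ_apply', coeff_shiftedHuffU, h]

theorem shift_first_identity {R : Type*} [CommRing R] {x f E E₇ E₄₉ t t₇ w y s : R}
    (hf : E₇ * f = E * (s * (t * y))) (hw4 : w ^ 4 = t * t₇) (hw : w * E = x ^ 2 * E₄₉) :
    x ^ 5 * f * (E₇ * t₇) = s * (w ^ 3 * y * (x ^ 7 * E₄₉)) := by
  linear_combination x ^ 5 * t₇ * hf - x ^ 5 * E * s * y * hw4 + x ^ 5 * s * y * w ^ 3 * hw

theorem shift_second_identity {R : Type*} [CommRing R] {x z E E' E₇ E₄₉ w y s : R}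
    (h : z * E = x * E₇ * (s * y)) (hE : E * E' = 1) (hw : w * E = x ^ 2 * E₄₉) :
    x * z * E₄₉ = s * (w * y * E₇) := by
  linear_combination x * E₄₉ * E' * h - x * z * E₄₉ * hE - s * y * E₇ * (E' * hw - w * hE)

/-- Multiplying by E(q^7) t(q^7) turns q^5 f into w^3 times a lattice element and a series in q^7;
after U, multiplying by q E(q^49) produces w times a lattice element. The first U only preserves
divisibility, the second gains the 7. -/
theorem exists_shiftedHuffU_lattice {e : ℕ} {f : ℤ⟦X⟧} {p : Polynomial ℤ}
    (hf : expand 7 (by norm_num) (pentagonalSeries ℤ) * f =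
      pentagonalSeries ℤ * (7 ^ e * (hauptmodul * Polynomial.aeval (7 * hauptmodul) p))) :
    ∃ q : Polynomial ℤ, expand 7 (by norm_num) (pentagonalSeries ℤ) * shiftedHuffU f =
      pentagonalSeries ℤ * (7 ^ (e + 1) * (hauptmodul * Polynomial.aeval (7 * hauptmodul) q)) := by
  obtain ⟨q1, hq1⟩ := exists_huffU_eulerQuotient_pow_three_mul p
  obtain ⟨q2, hq2⟩ := exists_huffU_eulerQuotient_mul q1
  refine ⟨q2, ?_⟩
  have h1 : huffU (X ^ 5 * f) * pentagonalSeries ℤ =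
      X * expand 7 (by norm_num) (pentagonalSeries ℤ) *
        (7 ^ e * Polynomial.aeval (7 * hauptmodul) q1) := by
    have h2 : X ^ 5 * f * expand 7 (by norm_num) (pentagonalSeries ℤ * hauptmodul) =
        7 ^ e * (eulerQuotient ^ 3 * Polynomial.aeval (7 * hauptmodul) p *
          expand 7 (by norm_num) (X * expand 7 (by norm_num) (pentagonalSeries ℤ))) := by
      rw [map_mul, map_mul, expand_X, expand_seven_expand_seven]
      exact shift_first_identity hf eulerQuotient_pow_four eulerQuotient_mul_pentagonalSeries
    have h3 := congrArg huffU h2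
    rw [huffU_mul_expand, huffU_seven_pow_mul, huffU_mul_expand, hq1] at h3
    apply mul_left_cancel₀ hauptmodul_ne_zero
    linear_combination h3
  have h2 : X * huffU (X ^ 5 * f) *
        expand 7 (by norm_num) (expand 7 (by norm_num) (pentagonalSeries ℤ)) =
      7 ^ e * (eulerQuotient * Polynomial.aeval (7 * hauptmodul) q1 *
        expand 7 (by norm_num) (pentagonalSeries ℤ)) := by
    rw [expand_seven_expand_seven]
    exact shift_second_identity h1 pentagonalSeries_mul_eulerInv eulerQuotient_mul_pentagonalSeries
  have h3 := congrArg huffU h2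
  rw [huffU_mul_expand, huffU_seven_pow_mul, huffU_mul_expand, hq2] at h3
  rw [shiftedHuffU]
  linear_combination h3

theorem exists_shiftedHuffU_iterate_lattice {e : ℕ} {f : ℤ⟦X⟧} {p : Polynomial ℤ} (β : ℕ)
    (hf : expand 7 (by norm_num) (pentagonalSeries ℤ) * f =
      pentagonalSeries ℤ * (7 ^ e * (hauptmodul * Polynomial.aeval (7 * hauptmodul) p))) :
    ∃ q : Polynomial ℤ, expand 7 (by norm_num) (pentagonalSeries ℤ) * shiftedHuffU^[β] f =
      pentagonalSeries ℤ * (7 ^ (e + β) * (hauptmodul * Polynomial.aeval (7 * hauptmodul) q)) := by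
  induction β with
  | zero => exact ⟨p, hf⟩
  | succ β ih =>
    obtain ⟨q, hq⟩ := ih
    rw [Function.iterate_succ_apply', ← add_assoc]
    exact exists_shiftedHuffU_lattice hq

theorem exists_seven_pow_dvd_regularPartitionCount_odd (k β n N : ℕ)
    (hN : 24 * N + 1 = 7 ^ (2 * (k + 1))) :
    ∃ c, 4 * c + 3 = 49 ^ β * (4 * n + 3) ∧ N ≤ 7 ^ (2 * k + 1) * (c + 1) ∧
    7 ^ (k + 1 + β) ∣
      regularPartitionCount (7 ^ (2 * k + 1)) (7 ^ (2 * k + 1) * (c + 1) - N) := by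
  obtain ⟨N', hN', h⟩ := exists_iteratedQuotient_eq (k + 1)
  obtain rfl : N' = N := by omega
  obtain ⟨q, hq⟩ := exists_huffU_iterate_iteratedQuotient k
  have h0 : expand (7 ^ (2 * (k + 1))) (by positivity) (pentagonalSeries ℤ) =
      expand (7 ^ (2 * k + 1)) (by positivity) (expand 7 (by norm_num) (pentagonalSeries ℤ)) := by
    rw [← expand_mul]
    simp only [← pow_succ, mul_add]
  -- Pulling E(q^(7^(2k+1))) out of U^(2k+1) leaves E(q), and pulling out E(q^(7^(2k+2))) leaves
  -- E(q^7); the two levels thus differ by the quotient E(q^7)/E(q).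
  have hf : expand 7 (by norm_num) (pentagonalSeries ℤ) *
      huffU^[2 * k + 1] (X ^ N' * regularSeries (7 ^ (2 * k + 1))) =
      pentagonalSeries ℤ *
        (7 ^ (k + 1) * (hauptmodul * Polynomial.aeval (7 * hauptmodul) q)) := by
    rw [← hq, mul_comm, ← huffU_iterate_mul_expand, mul_comm (pentagonalSeries ℤ),
      ← huffU_iterate_mul_expand, h, h0, regularSeries_eq (by positivity)]
    congr 1
    ring
  obtain ⟨q1, hq1⟩ := exists_shiftedHuffU_iterate_lattice β hf
  obtain ⟨c, hc, hcoeff⟩ := exists_coeff_shiftedHuffU_iterate β n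
  have hle : N' ≤ 7 ^ (2 * k + 1) * (c + 1) := by
    have h2 : 7 ^ (2 * (k + 1)) = 7 * 7 ^ (2 * k + 1) := by ring
    have h4 : 7 ^ (2 * k + 1) ≤ 7 ^ (2 * k + 1) * (c + 1) := Nat.le_mul_of_pos_right _ (by omega)
    omega
  refine ⟨c, hc, hle, ?_⟩
  have h1 := dvd_coeff_seven_pow_mul (k + 1 + β) (expand 7 (by norm_num) eulerInv *
    pentagonalSeries ℤ * (hauptmodul * Polynomial.aeval (7 * hauptmodul) q1)) (n + 1)
  have h2 : 7 ^ (k + 1 + β) * (expand 7 (by norm_num) eulerInv *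
      pentagonalSeries ℤ * (hauptmodul * Polynomial.aeval (7 * hauptmodul) q1)) =
      shiftedHuffU^[β] (huffU^[2 * k + 1] (X ^ N' * regularSeries (7 ^ (2 * k + 1)))) := by
    have h3 := expand_pentagonalSeries_mul_eulerInv (p := 7) (by norm_num)
    linear_combination
      shiftedHuffU^[β] (huffU^[2 * k + 1] (X ^ N' * regularSeries (7 ^ (2 * k + 1)))) * h3 -
      expand 7 (by norm_num) eulerInv * hq1
  rw [h2, hcoeff, coeff_huffU_iterate, coeff_X_pow_mul', if_pos hle, regularSeries, coeff_mk] at h1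
  exact_mod_cast h1

end OddLevel

/-! ### Matching the arithmetic progressions -/

theorem theorem1 (n β k : ℕ) (hk : 1 ≤ k) :
    (∃ m : ℕ,
      (m : ℚ) = 7 ^ (2 * k + 2 * β - 1) * (n : ℚ) +
        (18 * 7 ^ (2 * k + 2 * β - 1) - 7 ^ (2 * k - 1) + 1) / 24 ∧
      regularPartitionCount (7 ^ (2 * k - 1)) m ≡ 0 [MOD 7 ^ (k + β)]) ∧
    (∃ m : ℕ,
      (m : ℚ) = 7 ^ (2 * k + β - 1) * ((n : ℚ) + 1) - (7 ^ (2 * k) - 1) / 24 ∧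
      regularPartitionCount (7 ^ (2 * k)) m ≡ 0 [MOD 7 ^ (k + β)]) := by
  obtain ⟨k, rfl⟩ := Nat.exists_eq_add_of_le' hk
  obtain ⟨N, hN, -⟩ := exists_iteratedQuotient_eq (k + 1)
  have hNQ : 24 * (N : ℚ) + 1 = 7 * 7 ^ (2 * k + 1) := by
    have := congrArg (Nat.cast (R := ℚ)) hN
    push_cast at this
    rw [this]
    ring
  rw [show 2 * (k + 1) + 2 * β - 1 = 2 * k + 1 + 2 * β by omega,
    show 2 * (k + 1) - 1 = 2 * k + 1 by omega,
    show 2 * (k + 1) + β - 1 = 2 * k + 1 + β by omega]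
  constructor
  · obtain ⟨c, hc, hle, hdvd⟩ := exists_seven_pow_dvd_regularPartitionCount_odd k β n N hN
    refine ⟨_, ?_, (Nat.modEq_zero_iff_dvd).mpr hdvd⟩
    have hcQ := congrArg (Nat.cast (R := ℚ)) hc
    push_cast at hcQ
    rw [Nat.cast_sub hle, pow_add 7 (2 * k + 1) (2 * β), pow_mul 7 2 β]
    push_cast
    norm_num
    -- Here c + 1 = (49^β (4n + 3) + 1)/4 and N = (7 · 7^(2k+1) - 1)/24; the terms 6/24 and -7/24 of
    -- 7^(2k+1) leave the -1/24 in the claim.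
    linear_combination (7 ^ (2 * k + 1) / 4 : ℚ) * hcQ - hNQ / 24
  · refine ⟨_, ?_, (Nat.modEq_zero_iff_dvd).mpr
      (seven_pow_dvd_regularPartitionCount_even k β n N hN)⟩
    have hle : N ≤ 7 ^ (2 * k + 1 + β) * (n + 1) := by
      have h2 : 7 ^ (2 * (k + 1)) = 7 * 7 ^ (2 * k + 1) := by ring
      have h3 : 7 ^ (2 * k + 1) ≤ 7 ^ (2 * k + 1 + β) :=
        Nat.pow_le_pow_right (by norm_num) (by omega)
      have h4 : 7 ^ (2 * k + 1 + β) ≤ 7 ^ (2 * k + 1 + β) * (n + 1) :=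
        Nat.le_mul_of_pos_right _ (by omega)
      omega
    rw [Nat.cast_sub hle, show 2 * (k + 1) = 2 * k + 1 + 1 by ring, pow_succ 7 (2 * k + 1)]
    push_cast
    linear_combination -hNQ / 24
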